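/- **Lemma 4.2.** Let $k\ge 1$ and let $f$ range over the Lebesgue densities on $\mathbb R$ with $f(x)>0$ for all $x$ and $\int_{-\infty}^0 f=\int_0^\infty f=\tfrac12$; let $F$ be the distribution function of $f$. For $n\ge k+1$, let $Z^{(n)}=(Z^{(n)}_1,\dots,Z^{(n)}_n)$ be i.i.d. with density $f$, let $\mathbf N^{(n)}=(N^{(n)}_-,N^{(n)}_+)$ be the numbers of negative and of positive components, $R^{(n)}_t$ the rank of $Z^{(n)}_t$ among $Z^{(n)}_1,\dots,Z^{(n)}_n$, and $\mathbf Z^{(n)}_{(\cdot)}$ the vector of order statistics. A function $\varphi_k:(0,1)^{k+1}\to\mathbb R$ is called a *score-generating function* for the serial score functions $a^{(n)}_k\big((\eta,\nu);i_1,\dots,i_{k+1}\big)$ if, for every such $f$, the random variable $$\big\{a^{(n)}_k(\mathbf N^{(n)};R^{(n)}_{k+1},\dots,R^{(n)}_1)-\varphi_k(F(Z^{(n)}_{k+1}),\dots,F(Z^{(n)}_1))\big\}^2$$ is integrable for every $n\ge k+1$ and its conditional expectation given $\mathbf Z^{(n)}_{(\cdot)}$ tends to $0$ in probability as $n\to\infty$.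 Let $U_1,\dots,U_n$ be i.i.d. uniform on $(0,1)$, let $N_{U;-}$ and $N_{U;+}$ be the numbers of $U_t$ that are $<\tfrac12$ and $>\tfrac12$, and let $R_{U_t}$ be the rank of $U_t$ among $U_1,\dots,U_n$. The *exact* and *approximate* serial scores associated with $\varphi_k$ are $$a^{(n)}_{\varphi_k;\mathrm{ex}}((\eta,\nu);i_1,\dots,i_{k+1}):=E\big[\varphi_k(U_1,\dots,U_{k+1})\,\big|\,N_{U;-}=\eta,\ N_{U;+}=\nu,\ R_{U_1}=i_1,\dots,R_{U_{k+1}}=i_{k+1}\big],$$ $$a^{(n)}_{\varphi_k;\mathrm{appr}}((\eta,\nu);i_1,\dots,i_{k+1}):=\varphi_k\big(e_1,\dots,e_{k+1}\big),\qquad e_j:=E\big[U_j\,\big|\,N_{U;-}=\eta,\ N_{U;+}=\nu,\ R_{U_j}=i_j\big].$$ Let $\varphi_k:(0,1)^{k+1}\to\mathbb R$ be nonconstant and square-integrable. Then $\varphi_k$ is a score-generating function for the exact scores $a^{(n)}_{\varphi_k;\mathrm{ex}}$. If, moreover, $\varphi_k$ is a linear combination of finitely many square-integrable functions on $(0,1)^{k+1}$,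 each of which is monotone (nondecreasing or nonincreasing) in each argument when the other arguments are held fixed, then $\varphi_k$ is also a score-generating function for the approximate scores $a^{(n)}_{\varphi_k;\mathrm{appr}}$. -/

import Mathlib

open MeasureTheory ProbabilityTheory Filter Topology

universe u

noncomputable section

namespace SignRank

/-! ### Signs, ranks and order statistics of a finite sample `z = (z₁, …, zₙ)` -/

/-- The number of components of the sample `z` that lie strictly below `c`.
For `c = 0` this is the number of negative components. -/
def numBelow {n : ℕ} (c : ℝ) (z : Fin n → ℝ) : ℕ :=
  (Finset.univ.filter fun i => z i < c).card

/-- The number of components of the sample `z` that lie strictly above `c`.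
For `c = 0` this is the number of positive components. -/
def numAbove {n : ℕ} (c : ℝ) (z : Fin n → ℝ) : ℕ :=
  (Finset.univ.filter fun i => c < z i).card

/-- The rank (between `1` and `n`) of `z i` among `z₁, …, zₙ`. -/
def rank {n : ℕ} (z : Fin n → ℝ) (i : Fin n) : ℕ :=
  (Finset.univ.filter fun j => z j ≤ z i).card

/-- The vector of order statistics: the sample rearranged in nondecreasing order. -/
def orderStat {n : ℕ} (z : Fin n → ℝ) : Fin n → ℝ := z ∘ Tuple.sort z

/-- The vector of order statistics is a measurable function of the sample, so that it
generates a sub-σ-algebra. -/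
theorem measurable_orderStat {n : ℕ} :
    Measurable (orderStat : (Fin n → ℝ) → Fin n → ℝ) := by
  refine measurable_pi_lambda _ fun j => measurable_of_Iic fun a => ?_
  have hset : (fun z : Fin n → ℝ => orderStat z j) ⁻¹' Set.Iic a =
      {z | (j : ℕ) < ∑ i : Fin n, if z i ≤ a then 1 else 0} := by
    ext z
    have h := Tuple.lt_card_le_iff_apply_le_of_monotone (a := a) (j := j)
      (f := z ∘ Tuple.sort z) (Tuple.monotone_sort z)
    have hc : (Finset.univ.filter fun i => (z ∘ Tuple.sort z) i ≤ a).card =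
        ∑ i : Fin n, if z i ≤ a then 1 else 0 := by
      rw [Finset.card_filter]
      exact Equiv.sum_comp (Tuple.sort z) (fun i => if z i ≤ a then 1 else 0)
    simp only [Set.mem_preimage, Set.mem_Iic, Set.mem_ofPred_eq, orderStat, ← hc]
    exact h.symm
  rw [hset]
  refine measurableSet_lt measurable_const (Finset.measurable_sum _ fun i _ => ?_)
  exact Measurable.ite (measurableSet_le (measurable_pi_apply i) measurable_const)
    measurable_const measurable_const

/-! ### Zero-median white noise -/

/-- `f` is a nonvanishing probability density on the real line with median zero. -/
structure IsZeroMedianDensity (f : ℝ → ℝ) : Prop where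
  measurable : Measurable f
  pos : ∀ x, 0 < f x
  lintegral_neg : ∫⁻ x in Set.Iio 0, ENNReal.ofReal (f x) = 1 / 2
  lintegral_pos : ∫⁻ x in Set.Ioi 0, ENNReal.ofReal (f x) = 1 / 2

/-- The probability distribution on the real line with Lebesgue density `f`. -/
def law (f : ℝ → ℝ) : Measure ℝ := volume.withDensity fun x => ENNReal.ofReal (f x)

/-- `Z₁, …, Zₙ` are i.i.d. random variables with density `f`. -/
structure IsWhiteNoise {Ω : Type u} [MeasurableSpace Ω] (P : Measure Ω) (f : ℝ → ℝ)
    {n : ℕ} (Z : Fin n → Ω → ℝ) : Prop where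
  measurable : ∀ i, Measurable (Z i)
  indep : iIndepFun Z P
  map_eq : ∀ i, P.map (Z i) = law f

/-! ### Score functions and score-generating functions

Serial statistics of order `k` need a sample size `n ≥ k + 1`. It is written
`n = k + 1 + m` throughout, and `n → ∞` means `m → ∞`. -/

/-- A serial score function of order `k`, as a sequence: `a m (η, ν) i` is the score given by
the score function for the sample size `n = k + 1 + m` to the numbers `η` and `ν` of negative
and positive observations and the tuple `i` of `k + 1` ranks. -/
abbrev ScoreFunction (k : ℕ) : Type := ℕ → ℕ × ℕ → (Fin (k + 1) → ℕ) → ℝ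

/-- The squared error
`{a⁽ⁿ⁾(N; R_{k+1}, …, R_1) - φ(F(z_{k+1}), …, F(z_1))}²`, where `n = k + 1 + m`, `F` is the
distribution function of the density `f`, and `N = (N₋, N₊)` and the `R_t` are the sign counts
and the ranks of the sample `z`. -/
def sqError (k : ℕ) (a : ScoreFunction k) (φ : (Fin (k + 1) → ℝ) → ℝ) (f : ℝ → ℝ) (m : ℕ)
    (z : Fin (k + 1 + m) → ℝ) : ℝ :=
  (a m (numBelow 0 z, numAbove 0 z) (fun j => rank z (Fin.castAdd m j.rev)) -
    φ (fun j => cdf (law f) (z (Fin.castAdd m j.rev)))) ^ 2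

/-- `φ` is a score-generating function for the serial score function `a`: whatever the
zero-median density `f`, if for every sample size `n` the vector `Z⁽ⁿ⁾` is i.i.d. with density
`f`, then the conditional expectation of the squared error given the vector of order statistics
of `Z⁽ⁿ⁾` tends to zero in probability. (The integrability clause makes sure that the
conditional expectations are genuine.) -/
def IsScoreGenerating (k : ℕ) (a : ScoreFunction k) (φ : (Fin (k + 1) → ℝ) → ℝ) : Prop :=
  ∀ f : ℝ → ℝ, IsZeroMedianDensity f →
  ∀ (Ω : ℕ → Type u) [∀ m, MeasurableSpace (Ω m)] (P : ∀ m, Measure (Ω m))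
    [∀ m, IsProbabilityMeasure (P m)] (Z : ∀ m, Fin (k + 1 + m) → Ω m → ℝ),
    (∀ m, IsWhiteNoise (P m) f (Z m)) →
    (∀ m, Integrable (fun ω => sqError k a φ f m (fun i => Z m i ω)) (P m)) ∧
    ∀ ε : ℝ, 0 < ε →
      Tendsto
        (fun m => P m {ω | ε ≤ |condExp
          (MeasurableSpace.comap (fun ω => orderStat (fun i => Z m i ω)) MeasurableSpace.pi)
          (P m) (fun ω => sqError k a φ f m (fun i => Z m i ω)) ω|})
        atTop (𝓝 0)

/-! ### Exact and approximate scores -/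

/-- The law of `n` i.i.d. random variables uniformly distributed over `(0, 1)`. -/
def uniformSample (n : ℕ) : Measure (Fin n → ℝ) :=
  Measure.pi fun _ => volume.restrict (Set.Ioo (0 : ℝ) 1)

/-- The exact scores, for `n = k + 1 + m` and `U₁, …, Uₙ` i.i.d. uniform over `(0, 1)`:
`E[φ(U₁, …, U_{k+1}) | N₋ = η, N₊ = ν, R₁ = i₁, …, R_{k+1} = i_{k+1}]`,
where `N₋` and `N₊` are the numbers of `U_t` below and above `1/2`, and `R_t` is the rank
of `U_t` among `U₁, …, Uₙ`. -/
def exactScore (k : ℕ) (φ : (Fin (k + 1) → ℝ) → ℝ) : ScoreFunction k := fun m N i =>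
  ∫ v, φ (fun j => v (Fin.castAdd m j))
    ∂(ProbabilityTheory.cond (uniformSample (k + 1 + m))
      {v | numBelow (1 / 2) v = N.1 ∧ numAbove (1 / 2) v = N.2 ∧
        ∀ j, rank v (Fin.castAdd m j) = i j})

/-- The approximate scores, with the same notation:
`φ(E[U₁ | N₋ = η, N₊ = ν, R₁ = i₁], …, E[U_{k+1} | N₋ = η, N₊ = ν, R_{k+1} = i_{k+1}])`. -/
def approxScore (k : ℕ) (φ : (Fin (k + 1) → ℝ) → ℝ) : ScoreFunction k := fun m N i =>
  φ fun j => ∫ v, v (Fin.castAdd m j)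
    ∂(ProbabilityTheory.cond (uniformSample (k + 1 + m))
      {v | numBelow (1 / 2) v = N.1 ∧ numAbove (1 / 2) v = N.2 ∧
        rank v (Fin.castAdd m j) = i j})

/-! ### Functions on the open unit cube

A function on `(0, 1)^d` is represented by a function on all of `ℝ^d`. -/

/-- The open unit cube `(0, 1)^d`. -/
def openCube (d : ℕ) : Set (Fin d → ℝ) := {x | ∀ j, x j ∈ Set.Ioo (0 : ℝ) 1}

/-- `φ` is square-integrable over the open unit cube. -/
def SquareIntegrable {d : ℕ} (φ : (Fin d → ℝ) → ℝ) : Prop :=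
  MemLp φ 2 (volume.restrict (openCube d))

/-- On the open unit cube, `g` is monotone (nondecreasing or nonincreasing) in each of its
arguments when the other arguments are held fixed. -/
def MonotoneInEachArgument {d : ℕ} (g : (Fin d → ℝ) → ℝ) : Prop :=
  ∀ x ∈ openCube d, ∀ j,
    MonotoneOn (fun t => g (Function.update x j t)) (Set.Ioo 0 1) ∨
    AntitoneOn (fun t => g (Function.update x j t)) (Set.Ioo 0 1)

/-- On the open unit cube, `φ` is a linear combination of finitely many square-integrable
functions that are monotone in each argument. -/
def IsCombinationOfMonotone {d : ℕ} (φ : (Fin d → ℝ) → ℝ) : Prop :=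
  ∃ (r : ℕ) (c : Fin r → ℝ) (g : Fin r → (Fin d → ℝ) → ℝ),
    (∀ l, SquareIntegrable (g l) ∧ MonotoneInEachArgument (g l)) ∧
    ∀ x ∈ openCube d, φ x = ∑ l, c l * g l x

end SignRank

end

/-!
A condition on conditional expectations "in probability" follows from convergence to `0` of the
(unconditional) mean squared error, and the distribution function turns the sample into a uniform
one without changing ranks and sign counts (`isScoreGenerating_of_tendsto_eLpNorm`). So it is to
be shown that `a(N, R) - φ(U)` tends to `0` in mean square for uniform samples.

*Exact scores.* They are the means of `φ(U)` over the cells of the discrete variable `(N, R)`,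
hence the best mean square approximation to `φ(U)` by a function of `(N, R)`
(`eLpNorm_cellMean_sub_le`). A competitor is `h(R / n)`, with `h` continuous and close to `φ` in
mean square; it works since `R / n - U` tends to `0` (`tendsto_eLpNorm_rank_div_sub`).

*Approximate scores.* By linearity, `φ = g` may be taken monotone in each argument. The
conditional mean `E[U | N, R]` is again a best approximation, so it converges to `U` in mean
square. But its law is discrete, and square-integrability of `g` gives no control on `g` at such
points. The conditional mean is therefore enclosed in a random box: in each half of the unit
interval the conditional means are equidistant (`integral_cond_eq_condMean`), and each coordinate
of each vertex ("corner") of the box is uniformly distributed over the gap between neighbouring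
conditional means. By exchangeability, and since different gaps are disjoint, the law of each
corner has a density that is bounded uniformly in the sample size (`map_corner_le`). For such
variables, convergence `X - U → 0` in probability implies `g(X) - g(U) → 0` in mean square, for
any square-integrable `g`, by approximation by continuous functions
(`tendsto_eLpNorm_comp_sub_comp`). Finally a function that is monotone in each argument is
controlled within a box by its values at the vertices (`MonotoneInEachArgument.abs_sub_le_sum`).
-/

noncomputable section

namespace SignRank

open scoped ENNReal NNReal

/-! ### Mean squares: cell means and convergence in probability -/

theorem eLpNorm_two_le_eLpNorm_two {α : Type*} [MeasurableSpace α] {μ : Measure α} {f g : α → ℝ}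
    (h : ∫⁻ ω, ‖f ω‖ₑ ^ 2 ∂μ ≤ ∫⁻ ω, ‖g ω‖ₑ ^ 2 ∂μ) : eLpNorm f 2 μ ≤ eLpNorm g 2 μ := by
  rw [eLpNorm_eq_lintegral_rpow_enorm_toReal two_ne_zero ENNReal.ofNat_ne_top,
    eLpNorm_eq_lintegral_rpow_enorm_toReal two_ne_zero ENNReal.ofNat_ne_top]
  simp only [ENNReal.toReal_ofNat, ENNReal.rpow_ofNat]
  gcongr

theorem lintegral_enorm_sub_mean_sq_le {α : Type*} [MeasurableSpace α] {μ : Measure α}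
    [IsProbabilityMeasure μ] {X : α → ℝ} (hX : MemLp X 2 μ) (c : ℝ) :
    ∫⁻ ω, ‖μ[X] - X ω‖ₑ ^ 2 ∂μ ≤ ∫⁻ ω, ‖c - X ω‖ₑ ^ 2 ∂μ := by
  have h1 : ∫⁻ ω, ‖μ[X] - X ω‖ₑ ^ 2 ∂μ = ENNReal.ofReal (Var[X; μ]) := by
    rw [ofReal_variance hX, evariance]
    exact lintegral_congr fun ω => by rw [← enorm_neg, neg_sub]
  have hXc : MemLp (fun ω => X ω - c) 2 μ := hX.sub (memLp_const c)
  rw [h1, ← variance_sub_const hX.1 c]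
  refine (ENNReal.ofReal_le_ofReal (variance_le_expectation_sq hXc.1)).trans ?_
  simp only [Pi.pow_apply]
  rw [ofReal_integral_eq_lintegral_ofReal hXc.integrable_sq (ae_of_all _ fun ω => sq_nonneg _)]
  refine lintegral_mono fun ω => le_of_eq ?_
  rw [← enorm_neg, neg_sub, Real.enorm_eq_ofReal_abs, ← ENNReal.ofReal_pow (abs_nonneg _), sq_abs]

/-- Among all functions of a discrete variable `Y`, the mean over the cells `{Y = y}` is the best
mean square approximation to `X`. -/
theorem eLpNorm_cellMean_sub_le {α ι : Type*} [MeasurableSpace α] [Countable ι] {μ : Measure α}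
    [IsFiniteMeasure μ] {X : α → ℝ} (hX : MemLp X 2 μ) {Y : α → ι}
    (hY : ∀ y, MeasurableSet (Y ⁻¹' {y})) (h : ι → ℝ) :
    eLpNorm (fun ω => ∫ ω', X ω' ∂(cond μ (Y ⁻¹' {Y ω})) - X ω) 2 μ ≤
      eLpNorm (fun ω => h (Y ω) - X ω) 2 μ := by
  refine eLpNorm_two_le_eLpNorm_two ?_
  have hU : ⋃ y, Y ⁻¹' {y} = Set.univ := by
    ext ω; simp
  have hd : Pairwise (Function.onFun Disjoint fun y => Y ⁻¹' {y}) := fun y y' hne =>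
    Disjoint.preimage _ (by simpa using hne)
  rw [← setLIntegral_univ, ← hU, lintegral_iUnion hY hd,
    ← setLIntegral_univ (fun ω => ‖h (Y ω) - X ω‖ₑ ^ 2), ← hU, lintegral_iUnion hY hd]
  refine ENNReal.tsum_le_tsum fun y => ?_
  rcases eq_or_ne (μ (Y ⁻¹' {y})) 0 with h0 | h0
  · rw [Measure.restrict_eq_zero.2 h0]; simp
  have hr : μ.restrict (Y ⁻¹' {y}) = μ (Y ⁻¹' {y}) • cond μ (Y ⁻¹' {y}) := by
    rw [ProbabilityTheory.cond, smul_smul, ENNReal.mul_inv_cancel h0 (measure_ne_top _ _), one_smul]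
  have e1 : ∫⁻ ω in Y ⁻¹' {y}, ‖∫ ω', X ω' ∂(cond μ (Y ⁻¹' {Y ω})) - X ω‖ₑ ^ 2 ∂μ =
      ∫⁻ ω in Y ⁻¹' {y}, ‖∫ ω', X ω' ∂(cond μ (Y ⁻¹' {y})) - X ω‖ₑ ^ 2 ∂μ :=
    setLIntegral_congr_fun (hY y) fun ω hω => by
      have : Y ω = y := hω
      simp only [this]
  have e2 : ∫⁻ ω in Y ⁻¹' {y}, ‖h (Y ω) - X ω‖ₑ ^ 2 ∂μ =
      ∫⁻ ω in Y ⁻¹' {y}, ‖h y - X ω‖ₑ ^ 2 ∂μ :=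
    setLIntegral_congr_fun (hY y) fun ω hω => by
      have : Y ω = y := hω
      simp only [this]
  rw [e1, e2, hr, lintegral_smul_measure, lintegral_smul_measure]
  have := cond_isProbabilityMeasure (μ := μ) h0
  have hXc : MemLp X 2 (cond μ (Y ⁻¹' {y})) := by
    rw [ProbabilityTheory.cond]
    exact (hX.restrict _).smul_measure (ENNReal.inv_ne_top.2 h0)
  exact mul_le_mul' le_rfl (lintegral_enorm_sub_mean_sq_le hXc (h y))

theorem ae_measure_fiber_ne_zero {α ι : Type*} [MeasurableSpace α] [Countable ι] (μ : Measure α)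
    (Y : α → ι) : ∀ᵐ ω ∂μ, μ (Y ⁻¹' {Y ω}) ≠ 0 := by
  rw [ae_iff]
  have : {ω | ¬ μ (Y ⁻¹' {Y ω}) ≠ 0} ⊆ ⋃ y ∈ {y | μ (Y ⁻¹' {y}) = 0}, Y ⁻¹' {y} := by
    intro ω hω
    simp only [not_not, Set.mem_ofPred_eq] at hω
    simp only [Set.mem_iUnion]
    exact ⟨Y ω, hω, rfl⟩
  refine measure_mono_null this ?_
  exact (measure_biUnion_null_iff (Set.to_countable _)).2 fun y hy => hy

/-- A function of a discrete variable with finitely many values is square-integrable; discreteness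
supplies the measurability. -/
theorem memLp_of_countable_range {α ι : Type*} [MeasurableSpace α] [Countable ι] {μ : Measure α}
    [IsFiniteMeasure μ] {Y : α → ι} (hY : ∀ y, MeasurableSet (Y ⁻¹' {y}))
    {S : Set ι} (hS : S.Finite) (hYS : ∀ ω, Y ω ∈ S) (h : ι → ℝ) :
    MemLp (fun ω => h (Y ω)) 2 μ := by
  let _ : MeasurableSpace ι := ⊤
  have hm : Measurable Y := measurable_to_countable' hY
  have hmh : Measurable h := measurable_from_top
  obtain ⟨C, hC⟩ := (hS.image fun y => ‖h y‖).bddAbove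
  exact MemLp.of_bound (hmh.comp hm).aestronglyMeasurable C
    (ae_of_all _ fun ω => hC ⟨_, hYS ω, rfl⟩)

/-- If `X m - W m` tends to `0` in probability, then so does `h (X m) - h (W m)` in mean square,
for `h` continuous with compact support. -/
theorem tendsto_eLpNorm_comp_sub_comp_of_compactSupport {d : ℕ} {α : ℕ → Type*}
    [∀ m, MeasurableSpace (α m)] {P : ∀ m, Measure (α m)} [∀ m, IsProbabilityMeasure (P m)]
    {X W : ∀ m, α m → Fin d → ℝ} (hX : ∀ m, Measurable (X m)) (hW : ∀ m, Measurable (W m))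
    (hXW : ∀ ρ : ℝ, 0 < ρ → Tendsto (fun m => P m {ω | ρ ≤ dist (X m ω) (W m ω)}) atTop (𝓝 0))
    {h : (Fin d → ℝ) → ℝ} (hc : Continuous h) (hs : HasCompactSupport h) :
    Tendsto (fun m => eLpNorm (fun ω => h (X m ω) - h (W m ω)) 2 (P m)) atTop (𝓝 0) := by
  obtain ⟨M, hM⟩ := hs.exists_bound_of_continuous hc
  have hu := hs.uniformContinuous_of_continuous hc
  rw [Metric.uniformContinuous_iff] at hu
  rw [ENNReal.tendsto_nhds_zero]
  intro ε hε
  obtain ⟨δ, hδ0, hδ⟩ : ∃ δ : ℝ≥0, 0 < δ ∧ (δ : ℝ≥0∞) ≤ ε / 2 := by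
    obtain ⟨δ, hδ0, hδ⟩ := ENNReal.lt_iff_exists_nnreal_btwn.1 (ENNReal.half_pos hε.ne')
    exact ⟨δ, by simpa using hδ0, hδ.le⟩
  obtain ⟨ρ, hρ, hρ'⟩ := hu δ hδ0
  have hlim : Tendsto (fun m => ‖M + M‖ₑ * P m {ω | ρ ≤ dist (X m ω) (W m ω)} ^ (1 / 2 : ℝ))
      atTop (𝓝 0) := by
    have h1 := (hXW ρ hρ).ennrpow_const (1 / 2)
    have h2 := ENNReal.Tendsto.const_mul (a := ‖M + M‖ₑ) h1 (Or.inr enorm_ne_top)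
    simpa using h2
  filter_upwards [(ENNReal.tendsto_nhds_zero.1 hlim) (ε / 2) (ENNReal.half_pos hε.ne')] with m hm
  have hbad : MeasurableSet {ω | ρ ≤ dist (X m ω) (W m ω)} :=
    measurableSet_le measurable_const ((hX m).dist (hW m))
  calc eLpNorm (fun ω => h (X m ω) - h (W m ω)) 2 (P m)
      ≤ eLpNorm ((fun _ => (δ : ℝ)) +
          {ω | ρ ≤ dist (X m ω) (W m ω)}.indicator fun _ => M + M) 2 (P m) := by
        refine eLpNorm_mono_real fun ω => ?_
        by_cases hω : ρ ≤ dist (X m ω) (W m ω)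
        · have : ‖h (X m ω) - h (W m ω)‖ ≤ M + M :=
            (norm_sub_le _ _).trans (add_le_add (hM _) (hM _))
          simp only [Pi.add_apply, Set.indicator, Set.mem_ofPred_eq, hω, if_true]
          linarith [δ.2]
        · have := hρ' (not_le.1 hω)
          rw [Real.dist_eq] at this
          simpa [Set.indicator, hω] using this.le
    _ ≤ eLpNorm (fun _ => (δ : ℝ)) 2 (P m) +
          eLpNorm ({ω | ρ ≤ dist (X m ω) (W m ω)}.indicator fun _ => M + M) 2 (P m) :=
        eLpNorm_add_le aestronglyMeasurable_const
          ((aestronglyMeasurable_const).indicator hbad) (by norm_num)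
    _ ≤ ε / 2 + ε / 2 := by
        refine add_le_add ?_ ?_
        · rw [eLpNorm_const _ two_ne_zero (IsProbabilityMeasure.ne_zero _)]
          simpa using hδ
        · rw [eLpNorm_indicator_const hbad two_ne_zero ENNReal.ofNat_ne_top]
          simpa using hm
    _ = ε := ENNReal.add_halves ε

theorem memLp_comp_of_map_le {α β : Type*} [MeasurableSpace α] [MeasurableSpace β]
    {P : Measure α} {μ : Measure β} {C : ℝ≥0∞} (hC : C ≠ ∞) {X : α → β} (hX : Measurable X)
    (hle : P.map X ≤ C • μ) {g : β → ℝ} (hg : MemLp g 2 μ) : MemLp (fun ω => g (X ω)) 2 P :=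
  ((hg.smul_measure hC).mono_measure hle).comp_of_map hX.aemeasurable

theorem eLpNorm_comp_le_of_map_le {α β : Type*} [MeasurableSpace α] [MeasurableSpace β]
    {P : Measure α} {μ : Measure β} {C : ℝ≥0∞} (hC : C ≠ ∞) {X : α → β} (hX : Measurable X)
    (hle : P.map X ≤ C • μ) {g : β → ℝ} (hg : MemLp g 2 μ) :
    eLpNorm (fun ω => g (X ω)) 2 P ≤ C ^ (1 / 2 : ℝ) * eLpNorm g 2 μ := by
  have h1 : AEStronglyMeasurable g (P.map X) := ((hg.smul_measure hC).mono_measure hle).1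
  have h2 : eLpNorm (fun ω => g (X ω)) 2 P = eLpNorm g 2 (P.map X) :=
    (eLpNorm_map_measure h1 hX.aemeasurable).symm
  rw [h2]
  refine (eLpNorm_mono_measure g hle).trans (le_of_eq ?_)
  rw [eLpNorm_smul_measure_of_ne_top ENNReal.ofNat_ne_top]
  simp

/-- If the laws of `X m` and `W m` are dominated by a fixed multiple of `μ` and `X m - W m` tends
to `0` in probability, then `g (X m) - g (W m)` tends to `0` in mean square for every
square-integrable `g`, however irregular. -/
theorem tendsto_eLpNorm_comp_sub_comp {d : ℕ} {α : ℕ → Type*}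
    [∀ m, MeasurableSpace (α m)] {P : ∀ m, Measure (α m)} [∀ m, IsProbabilityMeasure (P m)]
    {μ : Measure (Fin d → ℝ)} [IsFiniteMeasure μ] {C : ℝ≥0∞} (hC : C ≠ ∞)
    {X W : ∀ m, α m → Fin d → ℝ} (hX : ∀ m, Measurable (X m)) (hW : ∀ m, Measurable (W m))
    (hXμ : ∀ m, (P m).map (X m) ≤ C • μ) (hWμ : ∀ m, (P m).map (W m) ≤ C • μ)
    (hXW : ∀ ρ : ℝ, 0 < ρ → Tendsto (fun m => P m {ω | ρ ≤ dist (X m ω) (W m ω)}) atTop (𝓝 0))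
    {g : (Fin d → ℝ) → ℝ} (hg : MemLp g 2 μ) :
    Tendsto (fun m => eLpNorm (fun ω => g (X m ω) - g (W m ω)) 2 (P m)) atTop (𝓝 0) := by
  rw [ENNReal.tendsto_nhds_zero]
  intro ε hε
  have hε3 : 0 < ε / 3 := ENNReal.div_pos hε.ne' (by norm_num)
  have hlim : Tendsto (fun δ : ℝ≥0∞ => C ^ (1 / 2 : ℝ) * δ) (𝓝 0) (𝓝 0) := by
    have := ENNReal.Tendsto.const_mul (a := C ^ (1 / 2 : ℝ)) (tendsto_id (α := ℝ≥0∞) (x := 𝓝 0))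
      (Or.inr (ENNReal.rpow_ne_top_of_nonneg (by norm_num) hC))
    simpa using this
  obtain ⟨δ, hδ, hδ0⟩ : ∃ δ : ℝ≥0∞, C ^ (1 / 2 : ℝ) * δ ≤ ε / 3 ∧ 0 < δ :=
    (((ENNReal.tendsto_nhds_zero.1 hlim (ε / 3) hε3).filter_mono nhdsWithin_le_nhds).and
      (self_mem_nhdsWithin : Set.Ioi (0 : ℝ≥0∞) ∈ 𝓝[>] 0)).exists
  obtain ⟨h, hs, hgh, hc, hh⟩ :=
    hg.exists_hasCompactSupport_eLpNorm_sub_le ENNReal.ofNat_ne_top hδ0.ne'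
  have hmem : MemLp (g - h) 2 μ := hg.sub hh
  filter_upwards [ENNReal.tendsto_nhds_zero.1
    (tendsto_eLpNorm_comp_sub_comp_of_compactSupport hX hW hXW hc hs) (ε / 3) hε3] with m hm
  have key : ∀ {V : α m → Fin d → ℝ}, Measurable V → (P m).map V ≤ C • μ →
      eLpNorm (fun ω => (g - h) (V ω)) 2 (P m) ≤ ε / 3 := fun hV hle =>
    (eLpNorm_comp_le_of_map_le hC hV hle hmem).trans ((by gcongr : _ ≤ _).trans hδ)
  have m1 := (memLp_comp_of_map_le hC (hX m) (hXμ m) hmem).1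
  have m2 := (memLp_comp_of_map_le hC (hW m) (hWμ m) hmem).1
  have m3 : AEStronglyMeasurable (fun ω => h (X m ω) - h (W m ω)) (P m) :=
    ((hc.measurable.comp (hX m)).sub (hc.measurable.comp (hW m))).aestronglyMeasurable
  have e : (fun ω => g (X m ω) - g (W m ω)) =
      ((fun ω => (g - h) (X m ω)) + fun ω => h (X m ω) - h (W m ω)) -
        fun ω => (g - h) (W m ω) := by
    ext ω; simp only [Pi.sub_apply, Pi.add_apply]; ring
  rw [e]
  calc _ ≤ _ := eLpNorm_sub_le (m1.add m3) m2 (by norm_num)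
    _ ≤ _ := add_le_add (eLpNorm_add_le m1 m3 (by norm_num)) le_rfl
    _ ≤ ε / 3 + ε / 3 + ε / 3 :=
        add_le_add (add_le_add (key (hX m) (hXμ m)) hm) (key (hW m) (hWμ m))
    _ = ε := ENNReal.add_thirds ε

/-! ### Uniform samples -/

/-- The uniform distribution over `(0, 1)`. -/
abbrev uniformLaw : Measure ℝ := volume.restrict (Set.Ioo (0 : ℝ) 1)

instance : IsProbabilityMeasure uniformLaw := ⟨by simp [uniformLaw]⟩

instance (n : ℕ) : IsProbabilityMeasure (uniformSample n) := by
  unfold uniformSample; infer_instance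

theorem openCube_eq_pi (n : ℕ) : openCube n = Set.univ.pi fun _ => Set.Ioo (0 : ℝ) 1 := by
  ext x; simp [openCube]

theorem measurableSet_openCube (n : ℕ) : MeasurableSet (openCube n) := by
  rw [openCube_eq_pi]
  exact MeasurableSet.univ_pi fun _ => measurableSet_Ioo

theorem uniformSample_eq (n : ℕ) : uniformSample n = volume.restrict (openCube n) := by
  rw [openCube_eq_pi, volume_pi, Measure.restrict_pi_pi]; rfl

theorem ae_mem_openCube (n : ℕ) : ∀ᵐ u ∂(uniformSample n), u ∈ openCube n := by
  rw [uniformSample_eq]; exact ae_restrict_mem (measurableSet_openCube n)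

theorem measurePreserving_uniformSample_eval {n : ℕ} (i : Fin n) :
    MeasurePreserving (fun u : Fin n → ℝ => u i) (uniformSample n) uniformLaw :=
  measurePreserving_eval (fun _ : Fin n => uniformLaw) i

theorem ae_ne_half (n : ℕ) : ∀ᵐ u ∂(uniformSample n), ∀ i, u i ≠ 1 / 2 := by
  rw [ae_all_iff]
  intro i
  exact (measurePreserving_uniformSample_eval i).quasiMeasurePreserving.ae
    (p := fun x => x ≠ 1 / 2) (Measure.ae_ne _ _)

theorem ae_injective (n : ℕ) : ∀ᵐ u ∂(uniformSample n), Function.Injective u := by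
  have h : ∀ i j : Fin n, i ≠ j → ∀ᵐ u ∂(uniformSample n), u i ≠ u j := by
    intro i j hij
    rw [uniformSample_eq]
    refine ae_restrict_of_ae ?_
    let L : (Fin n → ℝ) →ₗ[ℝ] ℝ := 
      LinearMap.proj (R := ℝ) (φ := fun _ => ℝ) i - LinearMap.proj (R := ℝ) (φ := fun _ => ℝ) j
    have hL : LinearMap.ker L ≠ ⊤ := by
      intro htop
      have : Pi.single i (1 : ℝ) ∈ LinearMap.ker L := htop ▸ Submodule.mem_top
      simp [L, hij] at this
    have := Measure.addHaar_submodule volume _ hL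
    rw [ae_iff]
    convert this using 2
    ext u
    simp [L, sub_eq_zero]
  have h' : ∀ᵐ u ∂(uniformSample n), ∀ i j : Fin n, i ≠ j → u i ≠ u j := by
    simp only [ae_all_iff]
    exact h
  filter_upwards [h'] with u hu i j hij
  by_contra hne
  exact hu i j hne hij

/-- Distinct components of a uniform sample form a uniform sample. -/
theorem measurePreserving_comp_injective {n d : ℕ} {τ : Fin d → Fin n}
    (hτ : Function.Injective τ) :
    MeasurePreserving (fun (u : Fin n → ℝ) j => u (τ j)) (uniformSample n) (uniformSample d) := by
  have hind : iIndepFun (fun (j : Fin n) (u : Fin n → ℝ) => u j) (uniformSample n) :=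
    iIndepFun_pi (μ := fun _ : Fin n => uniformLaw) (X := fun _ x => x)
      fun _ => measurable_id.aemeasurable
  have h2 := (iIndepFun_iff_map_fun_eq_pi_map fun j => (measurable_pi_apply (τ j)).aemeasurable).1
    (hind.precomp hτ)
  refine ⟨measurable_pi_lambda _ fun j => measurable_pi_apply _, h2.trans ?_⟩
  unfold uniformSample
  congr 1
  ext1 j
  exact (measurePreserving_uniformSample_eval (τ j)).map_eq

/-! ### Sign counts and ranks -/

theorem measurable_card_filter {α : Type*} [MeasurableSpace α] {n : ℕ} {p : α → Fin n → Prop}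
    [∀ a, DecidablePred (p a)] (h : ∀ i, MeasurableSet {a | p a i}) :
    Measurable fun a => (Finset.univ.filter (p a)).card := by
  simp only [Finset.card_filter]
  refine Finset.measurable_sum _ fun i _ => ?_
  exact Measurable.ite (h i) measurable_const measurable_const

theorem measurable_numBelow {n : ℕ} (c : ℝ) : Measurable (numBelow c : (Fin n → ℝ) → ℕ) :=
  measurable_card_filter fun i => measurableSet_lt (measurable_pi_apply i) measurable_const

theorem measurable_numAbove {n : ℕ} (c : ℝ) : Measurable (numAbove c : (Fin n → ℝ) → ℕ) :=
  measurable_card_filter fun i => measurableSet_lt measurable_const (measurable_pi_apply i)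

theorem measurable_rank {n : ℕ} (i : Fin n) : Measurable fun z : Fin n → ℝ => rank z i :=
  measurable_card_filter fun j => measurableSet_le (measurable_pi_apply j) (measurable_pi_apply i)

theorem numBelow_le {n : ℕ} (c : ℝ) (z : Fin n → ℝ) : numBelow c z ≤ n :=
  (Finset.card_le_univ _).trans_eq (Fintype.card_fin n)

theorem numAbove_le {n : ℕ} (c : ℝ) (z : Fin n → ℝ) : numAbove c z ≤ n :=
  (Finset.card_le_univ _).trans_eq (Fintype.card_fin n)

theorem rank_le {n : ℕ} (z : Fin n → ℝ) (i : Fin n) : rank z i ≤ n :=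
  (Finset.card_le_univ _).trans_eq (Fintype.card_fin n)

theorem one_le_rank {n : ℕ} (z : Fin n → ℝ) (i : Fin n) : 1 ≤ rank z i :=
  Finset.card_pos.2 ⟨i, by simp⟩

theorem numBelow_add_numAbove {n : ℕ} {c : ℝ} {z : Fin n → ℝ} (h : ∀ i, z i ≠ c) :
    numBelow c z + numAbove c z = n := by
  have : numAbove c z = (Finset.univ.filter fun i => ¬ z i < c).card := by
    unfold numAbove
    congr 1
    ext i
    simpa using (h i).symm.le_iff_lt.symm
  rw [this, numBelow, Finset.card_filter_add_card_filter_not, Finset.card_univ, Fintype.card_fin]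

theorem rank_lt_rank {n : ℕ} {z : Fin n → ℝ} {i j : Fin n} (h : z i < z j) :
    rank z i < rank z j := by
  refine Finset.card_lt_card ⟨fun l hl => ?_, fun hss => ?_⟩
  · simp only [Finset.mem_filter, Finset.mem_univ, true_and] at hl ⊢
    exact hl.trans h.le
  · have := hss (by simp : j ∈ Finset.univ.filter fun l => z l ≤ z j)
    simp only [Finset.mem_filter, Finset.mem_univ, true_and] at this
    exact absurd h (not_lt.2 this)

theorem rank_injective {n : ℕ} {z : Fin n → ℝ} (hz : Function.Injective z) :
    Function.Injective (rank z) := by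
  intro i j hij
  by_contra hne
  rcases lt_or_gt_of_ne (hz.ne hne) with h | h
  · exact (rank_lt_rank h).ne hij
  · exact (rank_lt_rank h).ne' hij

/-- The rank tells on which side of `c` an observation lies, once the number of observations
below `c` is known. -/
theorem rank_le_numBelow_iff {n : ℕ} {z : Fin n → ℝ} {i : Fin n} {c : ℝ} :
    rank z i ≤ numBelow c z ↔ z i < c := by
  constructor
  · intro h
    by_contra hc
    rw [not_lt] at hc
    refine (Finset.card_lt_card ⟨fun l hl => ?_, fun hss => ?_⟩ :
      numBelow c z < rank z i).not_ge h
    · simp only [Finset.mem_filter, Finset.mem_univ, true_and] at hl ⊢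
      exact hl.le.trans hc
    · have := hss (by simp : i ∈ Finset.univ.filter fun l => z l ≤ z i)
      simp only [Finset.mem_filter, Finset.mem_univ, true_and] at this
      exact absurd this (not_lt.2 hc)
  · intro h
    refine Finset.card_le_card fun l hl => ?_
    simp only [Finset.mem_filter, Finset.mem_univ, true_and] at hl ⊢
    exact hl.trans_lt h

theorem card_filter_comp_perm {n : ℕ} (π : Equiv.Perm (Fin n)) (p : Fin n → Prop)
    [DecidablePred p] :
    (Finset.univ.filter fun i => p (π i)).card = (Finset.univ.filter p).card := by
  rw [Finset.card_filter, Finset.card_filter]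
  exact Equiv.sum_comp π fun i => if p i then 1 else 0

theorem numBelow_comp_perm {n : ℕ} (c : ℝ) (z : Fin n → ℝ) (π : Equiv.Perm (Fin n)) :
    numBelow c (fun i => z (π i)) = numBelow c z :=
  card_filter_comp_perm π fun i => z i < c

theorem numAbove_comp_perm {n : ℕ} (c : ℝ) (z : Fin n → ℝ) (π : Equiv.Perm (Fin n)) :
    numAbove c (fun i => z (π i)) = numAbove c z :=
  card_filter_comp_perm π fun i => c < z i

theorem rank_comp_perm {n : ℕ} (z : Fin n → ℝ) (π : Equiv.Perm (Fin n)) (i : Fin n) :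
    rank (fun i => z (π i)) i = rank z (π i) :=
  card_filter_comp_perm π fun j => z j ≤ z (π i)

theorem rank_insertNth {n : ℕ} (i : Fin (n + 1)) (c : ℝ) (w : Fin n → ℝ) :
    rank (i.insertNth c w : Fin (n + 1) → ℝ) i =
      1 + (Finset.univ.filter fun l => w l ≤ c).card := by
  rw [rank, Finset.card_filter, Fin.sum_univ_succAbove _ i, Finset.card_filter]
  simp

theorem numBelow_insertNth {n : ℕ} (i : Fin (n + 1)) (a c : ℝ) (w : Fin n → ℝ) :
    numBelow a (i.insertNth c w : Fin (n + 1) → ℝ) =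
      (if c < a then 1 else 0) + (Finset.univ.filter fun l => w l < a).card := by
  rw [numBelow, Finset.card_filter, Fin.sum_univ_succAbove _ i, Finset.card_filter]
  simp

/-- Separation of the `i`-th component of a uniform sample from the others. -/
theorem measurePreserving_insertNth {n : ℕ} (i : Fin (n + 1)) :
    MeasurePreserving (fun p : ℝ × (Fin n → ℝ) => (i.insertNth p.1 p.2 : Fin (n + 1) → ℝ))
      (uniformLaw.prod (uniformSample n)) (uniformSample (n + 1)) :=
  (measurePreserving_piFinSuccAbove (fun _ : Fin (n + 1) => uniformLaw) i).symm

/-! ### Law of large numbers for ranks -/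

theorem integral_indicator_le_uniformSample {n : ℕ} (l : Fin n) {c : ℝ}
    (hc : c ∈ Set.Ioo (0 : ℝ) 1) :
    ∫ w, (if w l ≤ c then (1 : ℝ) else 0) ∂(uniformSample n) = c := by
  have h1 : ∫ w, (if w l ≤ c then (1 : ℝ) else 0) ∂(uniformSample n) =
      ∫ x, (if x ≤ c then (1 : ℝ) else 0) ∂uniformLaw := by
    rw [← (measurePreserving_uniformSample_eval l).map_eq]
    rw [integral_map (measurable_pi_apply l).aemeasurable]
    exact (Measurable.ite measurableSet_Iic measurable_const
      measurable_const).aestronglyMeasurable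
  have h2 : (fun x : ℝ => if x ≤ c then (1 : ℝ) else 0) = (Set.Iic c).indicator fun _ => 1 := by
    ext x; simp [Set.indicator]
  have h3 : Set.Iic c ∩ Set.Ioo 0 1 = Set.Ioc 0 c := by
    ext x
    simp only [Set.mem_inter_iff, Set.mem_Iic, Set.mem_Ioo, Set.mem_Ioc]
    exact ⟨fun h => ⟨h.2.1, h.1⟩, fun h => ⟨h.2, h.1, h.2.trans_lt hc.2⟩⟩
  rw [h1, h2, integral_indicator_const _ measurableSet_Iic, measureReal_def,
    Measure.restrict_apply measurableSet_Iic, h3]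
  simp [hc.1.le]

/-- Mean square deviation of the rank, among `n + 1` observations, of an observation with the
value `c`: the variance of a binomial count and the square of its bias `1 - c`. -/
theorem lintegral_count_sub_sq_le {n : ℕ} {c : ℝ} (hc : c ∈ Set.Ioo (0 : ℝ) 1) :
    ∫⁻ w : Fin n → ℝ, ‖((1 + (Finset.univ.filter fun l => w l ≤ c).card : ℕ) : ℝ) -
      ((n + 1 : ℕ) : ℝ) * c‖ₑ ^ 2 ∂(uniformSample n) ≤ ((n + 1 : ℕ) : ℝ≥0∞) := by
  let X : Fin n → ℝ → ℝ := fun _ x => if x ≤ c then 1 else 0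
  have hXm : ∀ l, Measurable (X l) := fun l =>
    Measurable.ite measurableSet_Iic measurable_const measurable_const
  have hX01 : ∀ l x, X l x ∈ Set.Icc (0 : ℝ) 1 := fun l x => by
    simp only [X]; split_ifs <;> simp
  have hXL : ∀ l, MemLp (X l) 2 uniformLaw := fun l =>
    MemLp.of_bound (hXm l).aestronglyMeasurable 1 (ae_of_all _ fun x => by
      rw [Real.norm_eq_abs, abs_of_nonneg (hX01 l x).1]; exact (hX01 l x).2)
  let S : (Fin n → ℝ) → ℝ := ∑ l, fun w => X l (w l)
  have hXS : ∀ l, MemLp (fun w : Fin n → ℝ => X l (w l)) 2 (uniformSample n) := fun l =>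
    (hXL l).comp_measurePreserving (measurePreserving_uniformSample_eval l)
  have hS : MemLp S 2 (uniformSample n) := memLp_finsetSum' _ fun l _ => hXS l
  have hES : ∫ w, S w ∂(uniformSample n) = n * c := by
    simp only [S, Finset.sum_apply]
    rw [integral_finsetSum _ fun l _ => (hXS l).integrable one_le_two]
    simp only [X, integral_indicator_le_uniformSample _ hc]
    simp
  have hVS : Var[S; uniformSample n] ≤ n * (1 / 4) := by
    have h1 : Var[S; uniformSample n] = ∑ l, Var[X l; uniformLaw] := variance_sum_pi hXL
    rw [h1]
    refine (Finset.sum_le_sum fun l _ => variance_le_sq_of_bounded (a := 0) (b := 1)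
      (ae_of_all _ (hX01 l)) (hXm l).aemeasurable).trans ?_
    norm_num
  -- The observation itself contributes `1` to its rank.
  let b : ℝ := (n + 1) * c - 1
  have hY : MemLp (fun w => S w - b) 2 (uniformSample n) := hS.sub (memLp_const b)
  have hEY : ∫ w, (S w - b) ∂(uniformSample n) = 1 - c := by
    rw [integral_sub (hS.integrable one_le_two) (integrable_const b), hES]
    simp [b]; ring
  have hVY : Var[fun w => S w - b; uniformSample n] = Var[S; uniformSample n] :=
    variance_sub_const hS.1 b
  have hsq : ∫ w, (S w - b) ^ 2 ∂(uniformSample n) ≤ n + 1 := by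
    have h1 := variance_eq_sub hY
    rw [hVY, hEY] at h1
    simp only [Pi.pow_apply] at h1
    nlinarith [hc.1, hc.2, (Nat.cast_nonneg n : (0 : ℝ) ≤ n)]
  have hcard : ∀ w : Fin n → ℝ, ((1 + (Finset.univ.filter fun l => w l ≤ c).card : ℕ) : ℝ) -
      ((n + 1 : ℕ) : ℝ) * c = S w - b := fun w => by
    have : S w = ((Finset.univ.filter fun l => w l ≤ c).card : ℝ) := by
      rw [Finset.card_filter]
      simp [S, X]
    rw [this]
    push_cast
    simp only [b]; ring
  simp only [hcard]
  calc ∫⁻ w, ‖S w - b‖ₑ ^ 2 ∂(uniformSample n)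
      = ∫⁻ w, ENNReal.ofReal ((S w - b) ^ 2) ∂(uniformSample n) := by
        refine lintegral_congr fun w => ?_
        rw [Real.enorm_eq_ofReal_abs, ← ENNReal.ofReal_pow (abs_nonneg _), sq_abs]
    _ = ENNReal.ofReal (∫ w, (S w - b) ^ 2 ∂(uniformSample n)) :=
        (ofReal_integral_eq_lintegral_ofReal hY.integrable_sq
          (ae_of_all _ fun w => sq_nonneg _)).symm
    _ ≤ ENNReal.ofReal (n + 1) := ENNReal.ofReal_le_ofReal hsq
    _ = ((n + 1 : ℕ) : ℝ≥0∞) := by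
        rw [← ENNReal.ofReal_natCast]; push_cast; rfl

theorem lintegral_rank_sub_sq_le {n : ℕ} (i : Fin n) :
    ∫⁻ u, ‖(rank u i : ℝ) - (n : ℝ) * u i‖ₑ ^ 2 ∂(uniformSample n) ≤ n := by
  cases n with
  | zero => exact i.elim0
  | succ n =>
    have hm : Measurable fun u : Fin (n + 1) → ℝ =>
        ‖(rank u i : ℝ) - ((n + 1 : ℕ) : ℝ) * u i‖ₑ ^ 2 := by
      have := measurable_rank i
      fun_prop
    have hp := measurePreserving_insertNth i
    rw [← hp.lintegral_comp hm]
    change ∫⁻ p, ((fun u : Fin (n + 1) → ℝ => ‖(rank u i : ℝ) - ((n + 1 : ℕ) : ℝ) * u i‖ₑ ^ 2) ∘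
      fun p : ℝ × (Fin n → ℝ) => (i.insertNth p.1 p.2 : Fin (n + 1) → ℝ)) p ∂_ ≤ _
    rw [lintegral_prod _ (hm.comp hp.measurable).aemeasurable]
    simp only [Function.comp_def, rank_insertNth, Fin.insertNth_apply_same]
    calc _ ≤ ∫⁻ _ : ℝ, ((n + 1 : ℕ) : ℝ≥0∞) ∂uniformLaw :=
          setLIntegral_mono' measurableSet_Ioo fun c hc => lintegral_count_sub_sq_le hc
      _ = _ := by simp

theorem eLpNorm_rank_div_sub_le {n : ℕ} (i : Fin n) :
    eLpNorm (fun u => (rank u i : ℝ) / n - u i) 2 (uniformSample n) ≤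
      ((n : ℝ≥0∞)⁻¹) ^ (1 / 2 : ℝ) := by
  have hn : (n : ℝ) ≠ 0 := by
    have := i.pos
    positivity
  rw [eLpNorm_eq_lintegral_rpow_enorm_toReal two_ne_zero ENNReal.ofNat_ne_top]
  simp only [ENNReal.toReal_ofNat, ENNReal.rpow_ofNat]
  gcongr
  have h1 : ∀ u : Fin n → ℝ, ‖(rank u i : ℝ) / n - u i‖ₑ ^ 2 =
      ((n : ℝ≥0∞)⁻¹) ^ 2 * ‖(rank u i : ℝ) - n * u i‖ₑ ^ 2 := fun u => by
    rw [← mul_pow]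
    congr 1
    have : (rank u i : ℝ) / n - u i = (n : ℝ)⁻¹ * ((rank u i : ℝ) - n * u i) := by
      field_simp
    rw [this, enorm_mul, enorm_inv hn]
    simp
  simp only [h1]
  have hn' : (n : ℝ≥0∞) ≠ 0 := by simpa using hn
  rw [lintegral_const_mul' _ _ (by simp [hn'])]
  calc _ ≤ ((n : ℝ≥0∞)⁻¹) ^ 2 * n := by gcongr; exact lintegral_rank_sub_sq_le i
    _ = _ := by
      rw [sq, mul_assoc, ENNReal.inv_mul_cancel hn' (ENNReal.natCast_ne_top n), mul_one]

theorem tendsto_inv_sampleSize (d : ℕ) :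
    Tendsto (fun m : ℕ => ((d + m : ℕ) : ℝ≥0∞)⁻¹) atTop (𝓝 0) :=
  ENNReal.tendsto_inv_nat_nhds_zero.comp
    (tendsto_atTop_mono (fun m => Nat.le_add_left m d) tendsto_id)

theorem tendsto_eLpNorm_rank_div_sub {d : ℕ} (j : Fin d) :
    Tendsto (fun m => eLpNorm (fun u : Fin (d + m) → ℝ =>
      (rank u (Fin.castAdd m j) : ℝ) / ((d + m : ℕ) : ℝ) - u (Fin.castAdd m j)) 2
        (uniformSample (d + m))) atTop (𝓝 0) := by
  have h := (tendsto_inv_sampleSize d).ennrpow_const (1 / 2)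
  rw [ENNReal.zero_rpow_of_pos (by norm_num)] at h
  exact tendsto_of_tendsto_of_tendsto_of_le_of_le tendsto_const_nhds h (fun _ => zero_le)
    fun m => eLpNorm_rank_div_sub_le _

/-! ### Conditional mean of an observation given the sign counts and its rank -/

/-- The multinomial law, up to the value of the multinomial coefficient. -/
theorem uniformSample_classCounts {n : ℕ} {ι : Type*} [Fintype ι] [DecidableEq ι]
    {cls : ℝ → ι} (hcls : ∀ a, MeasurableSet (cls ⁻¹' {a})) (N : ι → ℕ) :
    uniformSample n {w | ∀ a, (Finset.univ.filter fun l => cls (w l) = a).card = N a} =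
      (Finset.univ.filter fun y : Fin n → ι =>
        ∀ a, (Finset.univ.filter fun l => y l = a).card = N a).card *
        ∏ a, uniformLaw (cls ⁻¹' {a}) ^ N a := by
  set F := Finset.univ.filter fun y : Fin n → ι =>
        ∀ a, (Finset.univ.filter fun l => y l = a).card = N a
  let f : (Fin n → ℝ) → Fin n → ι := fun w l => cls (w l)
  have hf : ∀ y, f ⁻¹' {y} = Set.univ.pi fun l => cls ⁻¹' {y l} := fun y => by
    ext w; simp [f, funext_iff]
  have hset : {w : Fin n → ℝ | ∀ a, (Finset.univ.filter fun l => cls (w l) = a).card = N a} =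
      f ⁻¹' ↑F := by
    ext w; simp [f, F]
  rw [hset, ← sum_measure_preimage_singleton F fun y _ => by
    rw [hf]; exact MeasurableSet.univ_pi fun l => hcls _]
  rw [Finset.sum_eq_card_nsmul (b := ∏ a, uniformLaw (cls ⁻¹' {a}) ^ N a), nsmul_eq_mul]
  intro y hy
  rw [hf, uniformSample, Measure.pi_pi,
    ← Finset.prod_fiberwise Finset.univ y fun l => uniformLaw (cls ⁻¹' {y l})]
  refine Finset.prod_congr rfl fun a _ => ?_
  rw [Finset.prod_congr rfl (g := fun _ => uniformLaw (cls ⁻¹' {a})), Finset.prod_const]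
  · simp only [F, Finset.mem_filter, Finset.mem_univ, true_and] at hy
    rw [hy a]
  · intro l hl
    rw [(Finset.mem_filter.1 hl).2]

/-- The mean of the rescaled `Beta(p + 1, q + 1)` distribution, in unnormalised form: the integrand
is the derivative of `-(x - α) ^ (p + 1) * (β - x) ^ (q + 1) / (p + q + 2)`. -/
theorem integral_sub_betaMean_eq_zero {α β : ℝ} (p q : ℕ) :
    ∫ x in α..β, (x - (α + (β - α) * (p + 1) / (p + q + 2))) * ((x - α) ^ p * (β - x) ^ q) = 0 := by
  have hpq : (p + q + 2 : ℝ) ≠ 0 := by positivity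
  have hd : ∀ x : ℝ, HasDerivAt
      (fun x => -((x - α) ^ (p + 1) * (β - x) ^ (q + 1)) / (p + q + 2))
      ((x - (α + (β - α) * (p + 1) / (p + q + 2))) * ((x - α) ^ p * (β - x) ^ q)) x := by
    intro x
    have h1 : HasDerivAt (fun x => (x - α) ^ (p + 1)) (((p + 1 : ℕ) : ℝ) * (x - α) ^ p * 1) x := by
      simpa using ((hasDerivAt_id x).sub_const α).fun_pow (p + 1)
    have h2 : HasDerivAt (fun x => (β - x) ^ (q + 1))
        (((q + 1 : ℕ) : ℝ) * (β - x) ^ q * (-1)) x := by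
      simpa using ((hasDerivAt_id x).const_sub β).fun_pow (q + 1)
    refine ((h1.fun_mul h2).fun_neg.div_const (p + q + 2 : ℝ)).congr_deriv ?_
    field_simp
    push_cast
    ring
  rw [intervalIntegral.integral_eq_sub_of_hasDerivAt (fun x _ => hd x)
    (Continuous.intervalIntegrable (by fun_prop) _ _)]
  simp

/-- The conditional mean of an observation of rank `r` in a uniform sample, given the numbers `η`
and `ν` of observations below and above `1/2`: the observations in each half of the unit interval
divide it on average into equal parts. -/
def condMean (η ν r : ℕ) : ℝ :=
  if r ≤ η then r / (2 * (η + 1)) else 1 / 2 + ((r : ℝ) - η) / (2 * (ν + 1))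

theorem uniformLaw_of_inter_ae {s : Set ℝ} (hs : MeasurableSet s) {a b : ℝ}
    (h : (s ∩ Set.Ioo 0 1 : Set ℝ) =ᵐ[volume] (Set.Ioo a b : Set ℝ)) :
    uniformLaw s = ENNReal.ofReal (b - a) := by
  rw [Measure.restrict_apply hs, measure_congr h, Real.volume_Ioo]

/-- Left half: the density of the event `{N₋ = η, R = r}` at a value `c < 1/2` of the
observation. -/
theorem uniformSample_event_left (n η ν r : ℕ) (hη : η + ν = n + 1) (hr1 : 1 ≤ r) (hr : r ≤ η) :
    ∃ K : ℝ, ∀ c ∈ Set.Ioo (0 : ℝ) (1 / 2), (uniformSample n).real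
      {w | 1 + (Finset.univ.filter fun l => w l < 1 / 2).card = η ∧
        1 + (Finset.univ.filter fun l => w l ≤ c).card = r} =
      K * ((c - 0) ^ (r - 1) * (1 / 2 - c) ^ (η - r)) := by
  let N : Fin 3 → ℕ := ![r - 1, η - r, ν]
  refine ⟨((Finset.univ.filter fun y : Fin n → Fin 3 =>
        ∀ a, (Finset.univ.filter fun l => y l = a).card = N a).card : ℝ) * (1 / 2) ^ ν,
    fun c hc => ?_⟩
  let cls : ℝ → Fin 3 := fun x => if x ≤ c then 0 else if x < 1 / 2 then 1 else 2
  have h0 : cls ⁻¹' {0} = Set.Iic c := by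
    ext x; simp only [cls, Set.mem_preimage, Set.mem_singleton_iff, Set.mem_Iic]
    split_ifs <;> simp_all
  have h1 : cls ⁻¹' {1} = Set.Ioo c (1 / 2) := by
    ext x; simp only [cls, Set.mem_preimage, Set.mem_singleton_iff, Set.mem_Ioo]
    split_ifs <;> simp_all
  have h2 : cls ⁻¹' {2} = Set.Ici (1 / 2) := by
    ext x; simp only [cls, Set.mem_preimage, Set.mem_singleton_iff, Set.mem_Ici]
    split_ifs with h h'
    · simpa using h.trans_lt hc.2
    · simpa using h'
    · simpa using h'
  have hcls : ∀ a, MeasurableSet (cls ⁻¹' {a}) := by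
    intro a; fin_cases a
    · exact h0 ▸ measurableSet_Iic
    · exact h1 ▸ measurableSet_Ioo
    · exact h2 ▸ measurableSet_Ici
  have hset : {w : Fin n → ℝ | 1 + (Finset.univ.filter fun l => w l < 1 / 2).card = η ∧
        1 + (Finset.univ.filter fun l => w l ≤ c).card = r} =
      {w | ∀ a, (Finset.univ.filter fun l => cls (w l) = a).card = N a} := by
    ext w
    have e0 : (Finset.univ.filter fun l => cls (w l) = 0).card =
        (Finset.univ.filter fun l => w l ≤ c).card := by
      congr 1; ext l
      simpa using Set.ext_iff.1 h0 (w l)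
    have e1 : (Finset.univ.filter fun l => cls (w l) = 0).card +
        (Finset.univ.filter fun l => cls (w l) = 1).card =
        (Finset.univ.filter fun l => w l < 1 / 2).card := by
      rw [Finset.card_filter, Finset.card_filter, Finset.card_filter, ← Finset.sum_add_distrib]
      refine Finset.sum_congr rfl fun l _ => ?_
      simp only [cls]
      have := hc.2
      split_ifs <;> first | rfl | (exfalso; linarith) | simp_all
    have e2 : (Finset.univ.filter fun l => cls (w l) = 0).card +
        (Finset.univ.filter fun l => cls (w l) = 1).card +
        (Finset.univ.filter fun l => cls (w l) = 2).card = n := by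
      rw [Finset.card_filter, Finset.card_filter, Finset.card_filter, ← Finset.sum_add_distrib,
        ← Finset.sum_add_distrib, Finset.sum_congr rfl (g := fun _ => 1)]
      · simp
      · intro l _
        rcases (by decide : ∀ a : Fin 3, a = 0 ∨ a = 1 ∨ a = 2) (cls (w l)) with h | h | h <;>
          simp [h]
    simp only [Set.mem_ofPred_eq, Fin.forall_fin_succ, N, ← e0, ← e1]
    simp
    omega
  have m0 : uniformLaw (cls ⁻¹' {0}) = ENNReal.ofReal (c - 0) := by
    refine uniformLaw_of_inter_ae (hcls 0) ?_
    rw [h0]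
    suffices hs : Set.Iic c ∩ Set.Ioo 0 1 = Set.Ioc 0 c by
      rw [hs]; exact Ioo_ae_eq_Ioc.symm
    ext x
    have := hc.2
    simp only [Set.mem_inter_iff, Set.mem_Iic, Set.mem_Ioo, Set.mem_Ioc]
    constructor
    · rintro ⟨a, b, -⟩; exact ⟨b, a⟩
    · rintro ⟨a, b⟩; exact ⟨b, a, by linarith⟩
  have m1 : uniformLaw (cls ⁻¹' {1}) = ENNReal.ofReal (1 / 2 - c) := by
    refine uniformLaw_of_inter_ae (hcls 1) ?_
    rw [h1, Set.inter_eq_left.2]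
    · exact ae_eq_refl _
    exact fun x hx => ⟨hc.1.trans hx.1, hx.2.trans (by norm_num)⟩
  have m2 : uniformLaw (cls ⁻¹' {2}) = ENNReal.ofReal (1 - 1 / 2) := by
    refine uniformLaw_of_inter_ae (hcls 2) ?_
    rw [h2]
    suffices hs : Set.Ici (1 / 2 : ℝ) ∩ Set.Ioo 0 1 = Set.Ico (1 / 2) 1 by
      rw [hs]; exact Ioo_ae_eq_Ico.symm
    ext x
    simp only [Set.mem_inter_iff, Set.mem_Ici, Set.mem_Ioo, Set.mem_Ico]
    constructor
    · rintro ⟨a, -, b⟩; exact ⟨a, b⟩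
    · rintro ⟨a, b⟩; exact ⟨a, by linarith, b⟩
  rw [hset, measureReal_def, uniformSample_classCounts hcls N, Fin.prod_univ_three, m0, m1, m2]
  simp only [ENNReal.toReal_mul, ENNReal.toReal_pow, ENNReal.toReal_natCast]
  rw [ENNReal.toReal_ofReal (by linarith [hc.1]), ENNReal.toReal_ofReal (by linarith [hc.2]),
    ENNReal.toReal_ofReal (by norm_num)]
  simp only [N, Matrix.cons_val]
  rw [show (1 - 1 / 2 : ℝ) = 1 / 2 by norm_num]
  ring

/-- Right half: the density of the event `{N₋ = η, R = r}` at a value `c ≥ 1/2` of the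
observation. -/
theorem uniformSample_event_right (n η r : ℕ) (hr : η < r) :
    ∃ K : ℝ, ∀ c ∈ Set.Ico (1 / 2 : ℝ) 1, (uniformSample n).real
      {w | (Finset.univ.filter fun l => w l < 1 / 2).card = η ∧
        1 + (Finset.univ.filter fun l => w l ≤ c).card = r} =
      K * ((c - 1 / 2) ^ (r - 1 - η) * (1 - c) ^ (n + 1 - r)) := by
  let N : Fin 3 → ℕ := ![r - 1 - η, n + 1 - r, η]
  refine ⟨((Finset.univ.filter fun y : Fin n → Fin 3 =>
        ∀ a, (Finset.univ.filter fun l => y l = a).card = N a).card : ℝ) * (1 / 2) ^ η,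
    fun c hc => ?_⟩
  let cls : ℝ → Fin 3 := fun x => if x < 1 / 2 then 2 else if x ≤ c then 0 else 1
  have h2 : cls ⁻¹' {2} = Set.Iio (1 / 2) := by
    ext x; simp only [cls, Set.mem_preimage, Set.mem_singleton_iff, Set.mem_Iio]
    split_ifs <;> simp_all
  have h0 : cls ⁻¹' {0} = Set.Icc (1 / 2) c := by
    ext x; simp only [cls, Set.mem_preimage, Set.mem_singleton_iff, Set.mem_Icc]
    split_ifs <;> simp_all
  have h1 : cls ⁻¹' {1} = Set.Ioi c := by
    ext x; simp only [cls, Set.mem_preimage, Set.mem_singleton_iff, Set.mem_Ioi]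
    split_ifs with h h'
    · simpa using h.le.trans hc.1
    · simpa using h'
    · simpa using h'
  have hcls : ∀ a, MeasurableSet (cls ⁻¹' {a}) := by
    intro a; fin_cases a
    · exact h0 ▸ measurableSet_Icc
    · exact h1 ▸ measurableSet_Ioi
    · exact h2 ▸ measurableSet_Iio
  have hset : {w : Fin n → ℝ | (Finset.univ.filter fun l => w l < 1 / 2).card = η ∧
        1 + (Finset.univ.filter fun l => w l ≤ c).card = r} =
      {w | ∀ a, (Finset.univ.filter fun l => cls (w l) = a).card = N a} := by
    ext w
    have e0 : (Finset.univ.filter fun l => cls (w l) = 2).card =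
        (Finset.univ.filter fun l => w l < 1 / 2).card := by
      congr 1; ext l
      simpa using Set.ext_iff.1 h2 (w l)
    have e1 : (Finset.univ.filter fun l => cls (w l) = 2).card +
        (Finset.univ.filter fun l => cls (w l) = 0).card =
        (Finset.univ.filter fun l => w l ≤ c).card := by
      rw [Finset.card_filter, Finset.card_filter, Finset.card_filter, ← Finset.sum_add_distrib]
      refine Finset.sum_congr rfl fun l _ => ?_
      simp only [cls]
      have := hc.1
      split_ifs <;> first | rfl | (exfalso; linarith) | simp_all
    have e2 : (Finset.univ.filter fun l => cls (w l) = 0).card +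
        (Finset.univ.filter fun l => cls (w l) = 1).card +
        (Finset.univ.filter fun l => cls (w l) = 2).card = n := by
      rw [Finset.card_filter, Finset.card_filter, Finset.card_filter, ← Finset.sum_add_distrib,
        ← Finset.sum_add_distrib, Finset.sum_congr rfl (g := fun _ => 1)]
      · simp
      · intro l _
        rcases (by decide : ∀ a : Fin 3, a = 0 ∨ a = 1 ∨ a = 2) (cls (w l)) with h | h | h <;>
          simp [h]
    simp only [Set.mem_ofPred_eq, Fin.forall_fin_succ, N, ← e0, ← e1]
    simp
    omega
  have m0 : uniformLaw (cls ⁻¹' {0}) = ENNReal.ofReal (c - 1 / 2) := by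
    refine uniformLaw_of_inter_ae (hcls 0) ?_
    rw [h0, Set.inter_eq_left.2]
    · exact Ioo_ae_eq_Icc.symm
    · exact fun x hx => ⟨by linarith [hx.1], hx.2.trans_lt hc.2⟩
  have m1 : uniformLaw (cls ⁻¹' {1}) = ENNReal.ofReal (1 - c) := by
    refine uniformLaw_of_inter_ae (hcls 1) ?_
    rw [h1]
    suffices hs : Set.Ioi c ∩ Set.Ioo 0 1 = Set.Ioo c 1 by rw [hs]; exact ae_eq_refl _
    ext x
    have := hc.1
    simp only [Set.mem_inter_iff, Set.mem_Ioi, Set.mem_Ioo]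
    constructor
    · rintro ⟨a, -, b⟩; exact ⟨a, b⟩
    · rintro ⟨a, b⟩; exact ⟨a, by linarith, b⟩
  have m2 : uniformLaw (cls ⁻¹' {2}) = ENNReal.ofReal (1 / 2 - 0) := by
    refine uniformLaw_of_inter_ae (hcls 2) ?_
    rw [h2]
    suffices hs : Set.Iio (1 / 2 : ℝ) ∩ Set.Ioo 0 1 = Set.Ioo 0 (1 / 2) by
      rw [hs]; exact ae_eq_refl _
    ext x
    simp only [Set.mem_inter_iff, Set.mem_Iio, Set.mem_Ioo]
    constructor
    · rintro ⟨a, b, -⟩; exact ⟨b, a⟩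
    · rintro ⟨a, b⟩; exact ⟨b, a, by linarith⟩
  rw [hset, measureReal_def, uniformSample_classCounts hcls N, Fin.prod_univ_three, m0, m1, m2]
  simp only [ENNReal.toReal_mul, ENNReal.toReal_pow, ENNReal.toReal_natCast]
  rw [ENNReal.toReal_ofReal (by linarith [hc.1]), ENNReal.toReal_ofReal (by linarith [hc.2]),
    ENNReal.toReal_ofReal (by norm_num)]
  simp only [N, Matrix.cons_val]
  rw [sub_zero]
  ring

/-- The orthogonality relation that characterises the conditional mean. Separating the `i`-th
observation, the probability of the event at its value `c` is a multiple of
`(c - α) ^ p * (β - c) ^ q`, with `(α, β)` the half of the unit interval to which the rank `r`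
belongs. -/
theorem setIntegral_sub_condMean_eq_zero {n : ℕ} (i : Fin n) {η ν r : ℕ} (hη : η + ν = n)
    (hr1 : 1 ≤ r) (hrn : r ≤ n) :
    ∫ u in {u | numBelow (1 / 2) u = η ∧ rank u i = r}, (u i - condMean η ν r)
      ∂(uniformSample n) = 0 := by
  cases n with
  | zero => exact i.elim0
  | succ n =>
    set E := condMean η ν r with hE
    set A : Set (Fin (n + 1) → ℝ) := {u | numBelow (1 / 2) u = η ∧ rank u i = r}
    have hA : MeasurableSet A :=
      (measurable_numBelow _ (measurableSet_singleton η)).inter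
        (measurable_rank i (measurableSet_singleton r))
    have hp := measurePreserving_insertNth i
    have hint : Integrable (fun u : Fin (n + 1) → ℝ => A.indicator (fun u => u i - E) u)
        (uniformSample (n + 1)) := by
      refine Integrable.indicator ?_ hA
      refine Integrable.sub ?_ (integrable_const E)
      refine Integrable.of_bound (measurable_pi_apply i).aestronglyMeasurable 1 ?_
      filter_upwards [ae_mem_openCube (n + 1)] with u hu
      rw [Real.norm_eq_abs, abs_of_pos (hu i).1]
      exact (hu i).2.le
    let B : ℝ → Set (Fin n → ℝ) := fun c => {w | (i.insertNth c w : Fin (n + 1) → ℝ) ∈ A}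
    have hBm : ∀ c, MeasurableSet (B c) := fun c => by
      have : Measurable fun w : Fin n → ℝ => (i.insertNth c w : Fin (n + 1) → ℝ) :=
        hp.measurable.comp measurable_prodMk_left
      exact this hA
    have hB : ∀ c, B c = {w | (if c < 1 / 2 then 1 else 0) +
        (Finset.univ.filter fun l => w l < 1 / 2).card = η ∧
        1 + (Finset.univ.filter fun l => w l ≤ c).card = r} := fun c => by
      simp only [B, A, Set.mem_ofPred_eq, rank_insertNth, numBelow_insertNth]
    have hstep : ∫ u in A, (u i - E) ∂(uniformSample (n + 1)) =
        ∫ c in Set.Ioo (0 : ℝ) 1, (c - E) * (uniformSample n).real (B c) := by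
      rw [← integral_indicator hA]
      conv_lhs => rw [← hp.map_eq]
      rw [integral_map hp.measurable.aemeasurable (hp.map_eq ▸ hint.1)]
      rw [integral_prod]
      · refine integral_congr_ae (ae_of_all _ fun c => ?_)
        simp only
        have : (fun w : Fin n → ℝ => A.indicator (fun u => u i - E)
            (i.insertNth c w : Fin (n + 1) → ℝ)) = (B c).indicator fun _ => c - E := by
          ext w
          by_cases hw : (i.insertNth c w : Fin (n + 1) → ℝ) ∈ A
          · rw [Set.indicator_of_mem hw, Set.indicator_of_mem (show w ∈ B c from hw)]
            simp
          · rw [Set.indicator_of_notMem hw, Set.indicator_of_notMem (show w ∉ B c from hw)]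
        rw [this, integral_indicator_const _ (hBm c), smul_eq_mul, mul_comm]
      · exact (hp.integrable_comp hint.1).2 hint
    -- Whether the observation lies below `1/2` is determined by the event.
    have hside : ∀ c, (B c).Nonempty → (c < 1 / 2 ↔ r ≤ η) := by
      rintro c ⟨w, hw⟩
      have h := rank_le_numBelow_iff (z := (i.insertNth c w : Fin (n + 1) → ℝ)) (i := i)
        (c := 1 / 2)
      have hw' : (i.insertNth c w : Fin (n + 1) → ℝ) ∈ A := hw
      rw [hw'.1, hw'.2, Fin.insertNth_apply_same] at h
      exact h.symm
    rw [hstep]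
    rcases le_or_gt r η with hle | hlt
    · obtain ⟨K, hK⟩ := uniformSample_event_left n η ν r hη hr1 hle
      have hE' : E = 0 + (1 / 2 - 0) * (((r - 1 : ℕ) : ℝ) + 1) /
          (((r - 1 : ℕ) : ℝ) + ((η - r : ℕ) : ℝ) + 2) := by
        rw [hE, condMean, if_pos hle, Nat.cast_sub hr1, Nat.cast_sub hle]
        push_cast
        rw [show (r - 1 + (η - r) + 2 : ℝ) = η + 1 by ring]
        field_simp
        ring
      rw [setIntegral_eq_of_subset_of_forall_sdiff_eq_zero (s := Set.Ioo (0 : ℝ) (1 / 2))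
        measurableSet_Ioo (Set.Ioo_subset_Ioo_right (by norm_num))]
      · rw [setIntegral_congr_fun (g := fun c => K * ((c - E) * ((c - 0) ^ (r - 1) *
            (1 / 2 - c) ^ (η - r)))) measurableSet_Ioo, integral_const_mul,
          ← integral_Ioc_eq_integral_Ioo, ← intervalIntegral.integral_of_le (by norm_num), hE',
          integral_sub_betaMean_eq_zero, mul_zero]
        intro c hc
        simp only [hB, if_pos hc.2, hK c hc]
        ring
      · rintro c ⟨hc, hc'⟩
        have : B c = ∅ := Set.not_nonempty_iff_eq_empty.1 fun h =>
          hc' ⟨hc.1, (hside c h).2 hle⟩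
        simp [this]
    · obtain ⟨K, hK⟩ := uniformSample_event_right n η r hlt
      have hE' : E = 1 / 2 + (1 - 1 / 2) * (((r - 1 - η : ℕ) : ℝ) + 1) /
          (((r - 1 - η : ℕ) : ℝ) + ((n + 1 - r : ℕ) : ℝ) + 2) := by
        have hν : (ν : ℝ) = n + 1 - η := by
          rw [eq_sub_iff_add_eq']; exact_mod_cast hη
        rw [hE, condMean, if_neg (not_le.2 hlt), Nat.cast_sub (by omega), Nat.cast_sub hr1,
          Nat.cast_sub hrn, hν]
        push_cast
        rw [show (r - 1 - η + (n + 1 - r) + 2 : ℝ) = n + 1 - η + 1 by ring]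
        have : (n + 1 - η + 1 : ℝ) ≠ 0 := by rw [← hν]; positivity
        field_simp
        ring
      rw [setIntegral_eq_of_subset_of_forall_sdiff_eq_zero (s := Set.Ico (1 / 2 : ℝ) 1)
        measurableSet_Ioo]
      · rw [setIntegral_congr_fun (g := fun c => K * ((c - E) * ((c - 1 / 2) ^ (r - 1 - η) *
            (1 - c) ^ (n + 1 - r)))) measurableSet_Ico, integral_const_mul,
          integral_Ico_eq_integral_Ioo,
          ← integral_Ioc_eq_integral_Ioo, ← intervalIntegral.integral_of_le (by norm_num), hE',
          integral_sub_betaMean_eq_zero, mul_zero]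
        intro c hc
        simp only [hB, if_neg (not_lt.2 hc.1), zero_add, hK c hc]
        ring
      · exact fun c hc => ⟨by linarith [hc.1], hc.2⟩
      · rintro c ⟨hc, hc'⟩
        have : B c = ∅ := Set.not_nonempty_iff_eq_empty.1 fun h =>
          hc' ⟨not_lt.1 fun hlt' => (not_le.2 hlt) ((hside c h).1 hlt'), hc.2⟩
        simp [this]

theorem integral_cond_eq_condMean {n : ℕ} (i : Fin n) {η ν r : ℕ}
    (h0 : uniformSample n
      {v | numBelow (1 / 2) v = η ∧ numAbove (1 / 2) v = ν ∧ rank v i = r} ≠ 0) :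
    ∫ v, v i ∂(ProbabilityTheory.cond (uniformSample n)
      {v | numBelow (1 / 2) v = η ∧ numAbove (1 / 2) v = ν ∧ rank v i = r}) = condMean η ν r := by
  set A := {v : Fin n → ℝ | numBelow (1 / 2) v = η ∧ numAbove (1 / 2) v = ν ∧ rank v i = r}
    with hAdef
  -- An event of positive probability contains a sample without components equal to `1/2`.
  obtain ⟨v, hv, hvA⟩ : ∃ v : Fin n → ℝ, (∀ i, v i ≠ 1 / 2) ∧ v ∈ A := by
    by_contra hne
    refine h0 (measure_mono_null (fun v hvA => ?_) (ae_iff.1 (ae_ne_half n)))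
    exact fun hv => hne ⟨v, hv, hvA⟩
  have hην : η + ν = n := by
    rw [← hvA.1, ← hvA.2.1]; exact numBelow_add_numAbove hv
  have hr1 : 1 ≤ r := hvA.2.2 ▸ one_le_rank v i
  have hrn : r ≤ n := hvA.2.2 ▸ rank_le v i
  have hAA : A =ᵐ[uniformSample n] {u | numBelow (1 / 2) u = η ∧ rank u i = r} := by
    filter_upwards [ae_ne_half n] with u hu
    refine propext ⟨fun h => ⟨h.1, h.2.2⟩, fun h => ⟨h.1, ?_, h.2⟩⟩
    have h3 := numBelow_add_numAbove hu
    have h4 : numBelow (1 / 2) u = η := h.1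
    omega
  have hz := setIntegral_sub_condMean_eq_zero i hην hr1 hrn
  rw [← setIntegral_congr_set hAA, integral_sub, setIntegral_const] at hz
  · rw [ProbabilityTheory.cond, integral_smul_measure, sub_eq_zero.1 hz, smul_eq_mul, smul_eq_mul,
      ← mul_assoc, measureReal_def, ENNReal.toReal_inv, inv_mul_cancel₀, one_mul]
    exact ENNReal.toReal_ne_zero.2 ⟨h0, measure_ne_top _ _⟩
  · refine Integrable.of_bound (measurable_pi_apply i).aestronglyMeasurable 1 (ae_restrict_of_ae ?_)
    filter_upwards [ae_mem_openCube n] with u hu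
    rw [Real.norm_eq_abs, abs_of_pos (hu i).1]
    exact (hu i).2.le
  · exact integrable_const _

/-! ### Cells around the conditional means -/

/-- The distance between consecutive conditional means on the side of `1/2` of the observation of
rank `r`. -/
def cellWidth (η ν r : ℕ) : ℝ :=
  if r ≤ η then 1 / (2 * (η + 1)) else 1 / (2 * (ν + 1))

theorem cellWidth_pos (η ν r : ℕ) : 0 < cellWidth η ν r := by
  unfold cellWidth; split_ifs <;> positivity

theorem inv_cellWidth_le (η ν r : ℕ) : (cellWidth η ν r)⁻¹ ≤ 2 * ((η + ν : ℕ) + 1) := by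
  unfold cellWidth
  have h1 : (0 : ℝ) ≤ η := Nat.cast_nonneg η
  have h2 : (0 : ℝ) ≤ ν := Nat.cast_nonneg ν
  split_ifs <;> rw [one_div, inv_inv] <;> push_cast <;> linarith

/-- The cells on the right of the conditional means do not overlap. -/
theorem condMean_add_cellWidth_le (η ν : ℕ) {r r' : ℕ} (h : r < r') :
    condMean η ν r + cellWidth η ν r ≤ condMean η ν r' := by
  have hr : (r : ℝ) + 1 ≤ r' := by exact_mod_cast h
  unfold condMean cellWidth
  split_ifs with h1 h2 h2
  · rw [← add_div]; gcongr
  · have h3 : (r : ℝ) + 1 ≤ η + 1 := by exact_mod_cast Nat.succ_le_succ h1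
    have h4 : (η : ℝ) ≤ r' := by exact_mod_cast (not_le.1 h2).le
    have h5 : 0 ≤ ((r' : ℝ) - η) / (2 * (ν + 1)) := div_nonneg (by linarith) (by positivity)
    rw [← add_div]
    have h6 : ((r : ℝ) + 1) / (2 * (η + 1)) ≤ 1 / 2 := by
      rw [div_le_div_iff₀ (by positivity) two_pos]; linarith
    linarith
  · omega
  · rw [add_assoc, ← add_div]; gcongr; linarith

/-- The cells on the left of the conditional means do not overlap. -/
theorem condMean_le_sub_cellWidth (η ν : ℕ) {r r' : ℕ} (h : r < r') :
    condMean η ν r ≤ condMean η ν r' - cellWidth η ν r' := by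
  have hr : (r : ℝ) ≤ r' - 1 := by
    rw [le_sub_iff_add_le]; exact_mod_cast h
  unfold condMean cellWidth
  split_ifs with h1 h2 h2
  · rw [← sub_div]; gcongr
  · have h3 : (r : ℝ) ≤ η + 1 := by exact_mod_cast h1.trans (Nat.le_succ η)
    have h4 : (η : ℝ) + 1 ≤ r' := by exact_mod_cast (not_le.1 h2)
    have h5 : 0 ≤ ((r' : ℝ) - η - 1) / (2 * (ν + 1)) := div_nonneg (by linarith) (by positivity)
    rw [add_sub_assoc, ← sub_div]
    have h6 : (r : ℝ) / (2 * (η + 1)) ≤ 1 / 2 := by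
      rw [div_le_div_iff₀ (by positivity) two_pos]; linarith
    linarith
  · omega
  · rw [add_sub_assoc, ← sub_div]
    exact add_le_add le_rfl (div_le_div_of_nonneg_right (by linarith) (by positivity))

theorem cellWidth_le_condMean (η ν : ℕ) {r : ℕ} (h : 1 ≤ r) :
    cellWidth η ν r ≤ condMean η ν r := by
  have := condMean_le_sub_cellWidth η ν (r := 0) (r' := r) h
  simp only [condMean, Nat.zero_le, if_true, Nat.cast_zero, zero_div] at this ⊢
  linarith

theorem condMean_add_cellWidth_le_one (η ν : ℕ) {r : ℕ} (h : r ≤ η + ν) :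
    condMean η ν r + cellWidth η ν r ≤ 1 := by
  have h1 := condMean_add_cellWidth_le η ν (r := r) (r' := η + ν + 1) (by omega)
  have h2 : condMean η ν (η + ν + 1) = 1 := by
    rw [condMean, if_neg (by omega)]
    push_cast
    field_simp
    ring
  linarith

/-- The conditional mean of the `l`-th observation given the sign counts and its rank, as a
function of the sample. -/
def meanAt {n : ℕ} (u : Fin n → ℝ) (l : Fin n) : ℝ :=
  condMean (numBelow (1 / 2) u) (numAbove (1 / 2) u) (rank u l)

/-- The width of the cell of the `l`-th observation, as a function of the sample. -/
def widthAt {n : ℕ} (u : Fin n → ℝ) (l : Fin n) : ℝ :=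
  cellWidth (numBelow (1 / 2) u) (numAbove (1 / 2) u) (rank u l)

/-- The interval of width `widthAt u l` on the right (for `true`) or on the left (for `false`) of
the conditional mean of the `l`-th observation. -/
def cell {n : ℕ} (b : Bool) (u : Fin n → ℝ) (l : Fin n) : Set ℝ :=
  if b then Set.Ioo (meanAt u l) (meanAt u l + widthAt u l)
  else Set.Ioo (meanAt u l - widthAt u l) (meanAt u l)

/-- `1` for `true` and `-1` for `false`. -/
def sgn (b : Bool) : ℝ := if b then 1 else -1

theorem abs_sgn (b : Bool) : |sgn b| = 1 := by cases b <;> simp [sgn]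

/-- The vector with components in the cells of the observations `τ j`, at relative distances `t j`
from the conditional means, on the sides given by `σ`. -/
def corner {n d : ℕ} (σ : Fin d → Bool) (u : Fin n → ℝ) (τ : Fin d → Fin n) (t : Fin d → ℝ) :
    Fin d → ℝ :=
  fun j => meanAt u (τ j) + sgn (σ j) * (t j * widthAt u (τ j))

theorem measurable_countSummary {n : ℕ} {β : Type*} [MeasurableSpace β] (F : ℕ → ℕ → ℕ → β)
    (l : Fin n) :
    Measurable fun u : Fin n → ℝ => F (numBelow (1 / 2) u) (numAbove (1 / 2) u) (rank u l) :=
  (measurable_of_countable fun p : ℕ × ℕ × ℕ => F p.1 p.2.1 p.2.2).comp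
    ((measurable_numBelow _).prodMk ((measurable_numAbove _).prodMk (measurable_rank l)))

theorem measurable_meanAt {n : ℕ} (l : Fin n) : Measurable fun u : Fin n → ℝ => meanAt u l :=
  measurable_countSummary condMean l

theorem measurable_widthAt {n : ℕ} (l : Fin n) : Measurable fun u : Fin n → ℝ => widthAt u l :=
  measurable_countSummary cellWidth l

theorem measurable_corner {n d : ℕ} (σ : Fin d → Bool) (τ : Fin d → Fin n) :
    Measurable fun p : (Fin n → ℝ) × (Fin d → ℝ) => corner σ p.1 τ p.2 := by
  refine measurable_pi_lambda _ fun j => ?_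
  have h1 : Measurable fun p : (Fin n → ℝ) × (Fin d → ℝ) => meanAt p.1 (τ j) :=
    (measurable_meanAt (τ j)).comp measurable_fst
  have h2 : Measurable fun p : (Fin n → ℝ) × (Fin d → ℝ) => widthAt p.1 (τ j) :=
    (measurable_widthAt (τ j)).comp measurable_fst
  have h3 : Measurable fun p : (Fin n → ℝ) × (Fin d → ℝ) => p.2 j :=
    (measurable_pi_apply j).comp measurable_snd
  exact h1.add ((h3.mul h2).const_mul _)

theorem meanAt_comp_perm {n : ℕ} (u : Fin n → ℝ) (π : Equiv.Perm (Fin n)) (l : Fin n) :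
    meanAt (fun i => u (π i)) l = meanAt u (π l) := by
  rw [meanAt, numBelow_comp_perm, numAbove_comp_perm, rank_comp_perm]; rfl

theorem widthAt_comp_perm {n : ℕ} (u : Fin n → ℝ) (π : Equiv.Perm (Fin n)) (l : Fin n) :
    widthAt (fun i => u (π i)) l = widthAt u (π l) := by
  rw [widthAt, numBelow_comp_perm, numAbove_comp_perm, rank_comp_perm]; rfl

theorem widthAt_pos {n : ℕ} (u : Fin n → ℝ) (l : Fin n) : 0 < widthAt u l := cellWidth_pos _ _ _

theorem widthAt_le_meanAt {n : ℕ} (u : Fin n → ℝ) (l : Fin n) : widthAt u l ≤ meanAt u l :=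
  cellWidth_le_condMean _ _ (one_le_rank u l)

theorem meanAt_add_widthAt_le_one {n : ℕ} {u : Fin n → ℝ} (hu : ∀ i, u i ≠ 1 / 2) (l : Fin n) :
    meanAt u l + widthAt u l ≤ 1 :=
  condMean_add_cellWidth_le_one _ _ ((rank_le u l).trans (numBelow_add_numAbove hu).ge)

theorem meanAt_mem_Ioo {n : ℕ} {u : Fin n → ℝ} (hu : ∀ i, u i ≠ 1 / 2) (l : Fin n) :
    meanAt u l ∈ Set.Ioo (0 : ℝ) 1 :=
  ⟨(widthAt_pos u l).trans_le (widthAt_le_meanAt u l),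
    by linarith [widthAt_pos u l, meanAt_add_widthAt_le_one hu l]⟩

theorem cell_subset_Ioo {n : ℕ} {u : Fin n → ℝ} (hu : ∀ i, u i ≠ 1 / 2) (b : Bool) (l : Fin n) :
    cell b u l ⊆ Set.Ioo (0 : ℝ) 1 := by
  have h1 := widthAt_le_meanAt u l
  have h2 := meanAt_add_widthAt_le_one hu l
  have h3 := meanAt_mem_Ioo hu l
  cases b
  · exact fun x hx => ⟨by linarith [hx.1], by linarith [hx.2, h3.2]⟩
  · exact fun x hx => ⟨by linarith [hx.1, h3.1], by linarith [hx.2]⟩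

theorem measurableSet_cell {n : ℕ} (b : Bool) (u : Fin n → ℝ) (l : Fin n) :
    MeasurableSet (cell b u l) := by
  unfold cell; split_ifs <;> exact measurableSet_Ioo

theorem volume_cell {n : ℕ} (b : Bool) (u : Fin n → ℝ) (l : Fin n) :
    volume (cell b u l) = ENNReal.ofReal (widthAt u l) := by
  cases b <;> simp [cell]

theorem disjoint_cell {n : ℕ} {u : Fin n → ℝ} (hu : Function.Injective u) (b : Bool)
    {l l' : Fin n} (hl : l ≠ l') : Disjoint (cell b u l) (cell b u l') := by
  have key : ∀ {l l' : Fin n}, rank u l < rank u l' → Disjoint (cell b u l) (cell b u l') := by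
    intro l l' h
    rw [Set.disjoint_left]
    intro x hx hx'
    have h1 := condMean_add_cellWidth_le (numBelow (1 / 2) u) (numAbove (1 / 2) u) h
    have h2 := condMean_le_sub_cellWidth (numBelow (1 / 2) u) (numAbove (1 / 2) u) h
    change meanAt u l + widthAt u l ≤ meanAt u l' at h1
    change meanAt u l ≤ meanAt u l' - widthAt u l' at h2
    cases b
    · have a1 := hx.2
      have a2 := hx'.1
      linarith
    · have a1 := hx.2
      have a2 := hx'.1
      linarith
  rcases lt_or_gt_of_ne ((rank_injective hu).ne hl) with h | h
  · exact key h
  · exact (key h).symm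

theorem corner_mem_cell {n d : ℕ} (σ : Fin d → Bool) (u : Fin n → ℝ) (τ : Fin d → Fin n)
    {t : Fin d → ℝ} (ht : t ∈ openCube d) (j : Fin d) :
    corner σ u τ t j ∈ cell (σ j) u (τ j) := by
  have hw := widthAt_pos u (τ j)
  have h1 : 0 < t j * widthAt u (τ j) := mul_pos (ht j).1 hw
  have h2 : t j * widthAt u (τ j) < widthAt u (τ j) := by nlinarith [(ht j).2]
  simp only [corner, sgn, cell]
  cases σ j <;> simp <;> constructor <;> linarith

/-! ### The law of the corners is dominated by a multiple of the uniform law -/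

/-- A corner is an affine image of a uniform point, with derivative of determinant at least
`(2 * (n + 1)) ^ (-d)` in absolute value. -/
theorem uniformSample_corner_preimage_le {n d : ℕ} (σ : Fin d → Bool) {u : Fin n → ℝ}
    (hu : ∀ i, u i ≠ 1 / 2) (τ : Fin d → Fin n) (B : Set (Fin d → ℝ)) :
    uniformSample d {t | corner σ u τ t ∈ B} ≤ ENNReal.ofReal ((2 * (n + 1)) ^ d) *
      uniformSample d (B ∩ Set.univ.pi fun j => cell (σ j) u (τ j)) := by
  set Q : Set (Fin d → ℝ) := Set.univ.pi fun j => cell (σ j) u (τ j)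
  have hQm : MeasurableSet Q := MeasurableSet.univ_pi fun j => measurableSet_cell _ _ _
  have hQ : Q ⊆ openCube d := fun x hx j => cell_subset_Ioo hu _ _ (hx j trivial)
  let D : Fin d → ℝ := fun j => sgn (σ j) * widthAt u (τ j)
  have hD : ∀ j, |D j| = widthAt u (τ j) := fun j => by
    rw [abs_mul, abs_sgn, one_mul, abs_of_pos (widthAt_pos _ _)]
  let f : (Fin d → ℝ) →ₗ[ℝ] (Fin d → ℝ) := Matrix.toLin' (Matrix.diagonal D)
  have hdet : LinearMap.det f = ∏ j, D j := by
    rw [LinearMap.det_toLin', Matrix.det_diagonal]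
  have hdet0 : LinearMap.det f ≠ 0 := by
    rw [hdet]
    refine Finset.prod_ne_zero_iff.2 fun j _ => abs_ne_zero.1 ?_
    rw [hD]; exact (widthAt_pos _ _).ne'
  have hcorner : ∀ t, corner σ u τ t = (fun j => meanAt u (τ j)) + f t := fun t => by
    ext j
    simp only [corner, f, Matrix.toLin'_apply, Matrix.mulVec_diagonal, Pi.add_apply, D]
    ring
  have hbound : |(LinearMap.det f)⁻¹| ≤ (2 * (n + 1)) ^ d := by
    rw [abs_inv, hdet, Finset.abs_prod, ← Finset.prod_inv_distrib]
    calc ∏ j, |D j|⁻¹ ≤ ∏ _j : Fin d, (2 * ((n : ℝ) + 1)) := by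
          refine Finset.prod_le_prod (fun j _ => by positivity) fun j _ => ?_
          rw [hD]
          have := inv_cellWidth_le (numBelow (1 / 2) u) (numAbove (1 / 2) u) (rank u (τ j))
          rwa [numBelow_add_numAbove hu] at this
      _ = _ := by simp
  have hsub : {t | corner σ u τ t ∈ B} ∩ openCube d ⊆
      f ⁻¹' ((fun x => (fun j => meanAt u (τ j)) + x) ⁻¹' (B ∩ Q)) := by
    rintro t ⟨ht, htc⟩
    have hmem : corner σ u τ t ∈ B ∩ Q := ⟨ht, fun j _ => corner_mem_cell σ u τ htc j⟩
    rwa [hcorner] at hmem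
  calc uniformSample d {t | corner σ u τ t ∈ B}
      = volume ({t | corner σ u τ t ∈ B} ∩ openCube d) := by
        rw [uniformSample_eq, Measure.restrict_apply' (measurableSet_openCube d)]
    _ ≤ volume (f ⁻¹' ((fun x => (fun j => meanAt u (τ j)) + x) ⁻¹' (B ∩ Q))) :=
        measure_mono hsub
    _ = ENNReal.ofReal |(LinearMap.det f)⁻¹| * volume (B ∩ Q) := by
        rw [Measure.addHaar_preimage_linearMap _ hdet0, measure_preimage_add]
    _ ≤ ENNReal.ofReal ((2 * (n + 1)) ^ d) * volume (B ∩ Q) := by gcongr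
    _ = _ := by
        rw [uniformSample_eq, Measure.restrict_apply' (measurableSet_openCube d),
          Set.inter_eq_left.2 (Set.inter_subset_right.trans hQ)]

theorem sum_uniformSample_corner_preimage_le {n d : ℕ} (σ : Fin d → Bool) {u : Fin n → ℝ}
    (hu : ∀ i, u i ≠ 1 / 2) (hinj : Function.Injective u) {B : Set (Fin d → ℝ)}
    (hB : MeasurableSet B) :
    ∑ τ : Fin d ↪ Fin n, uniformSample d {t | corner σ u τ t ∈ B} ≤
      ENNReal.ofReal ((2 * (n + 1)) ^ d) * uniformSample d B := by
  calc _ ≤ ∑ τ : Fin d ↪ Fin n, ENNReal.ofReal ((2 * (n + 1)) ^ d) *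
        uniformSample d (B ∩ Set.univ.pi fun j => cell (σ j) u (τ j)) :=
        Finset.sum_le_sum fun τ _ => uniformSample_corner_preimage_le σ hu τ B
    _ = ENNReal.ofReal ((2 * (n + 1)) ^ d) * ∑ τ : Fin d ↪ Fin n,
        ((uniformSample d).restrict B) (Set.univ.pi fun j => cell (σ j) u (τ j)) := by
        rw [Finset.mul_sum]
        refine Finset.sum_congr rfl fun τ _ => ?_
        rw [Measure.restrict_apply' hB, Set.inter_comm]
    _ ≤ ENNReal.ofReal ((2 * (n + 1)) ^ d) * ((uniformSample d).restrict B) Set.univ := by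
        gcongr
        refine sum_measure_le_measure_univ (fun τ _ => (MeasurableSet.univ_pi fun j =>
          measurableSet_cell _ _ _).nullMeasurableSet) fun τ _ τ' _ hne => ?_
        refine Disjoint.aedisjoint ?_
        obtain ⟨j, hj⟩ : ∃ j, τ j ≠ τ' j := by
          by_contra hcon
          push Not at hcon
          exact hne (DFunLike.ext _ _ hcon)
        exact Set.disjoint_left.2 fun x hx hx' =>
          Set.disjoint_left.1 (disjoint_cell hinj (σ j) hj) (hx j trivial) (hx' j trivial)
    _ = _ := by rw [Measure.restrict_apply_univ]

theorem ae_good (n : ℕ) : ∀ᵐ u ∂(uniformSample n),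
    u ∈ openCube n ∧ (∀ i, u i ≠ 1 / 2) ∧ Function.Injective u := by
  filter_upwards [ae_mem_openCube n, ae_ne_half n, ae_injective n] with u h1 h2 h3
  exact ⟨h1, h2, h3⟩

/-- By exchangeability, the law of the corners is the average over all choices of `d` distinct
observations; the corresponding cells are disjoint. -/
theorem map_corner_le (d m : ℕ) (σ : Fin d → Bool) :
    ((uniformSample (d + m)).prod (uniformSample d)).map
      (fun p => corner σ p.1 (Fin.castAdd m) p.2) ≤
      ENNReal.ofReal ((2 * (d + 1)) ^ d) • uniformSample d := by
  refine Measure.le_iff.2 fun B hB => ?_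
  have hSm : ∀ τ : Fin d → Fin (d + m), MeasurableSet
      {p : (Fin (d + m) → ℝ) × (Fin d → ℝ) | corner σ p.1 τ p.2 ∈ B} := fun τ =>
    measurable_corner σ τ hB
  rw [Measure.map_apply (measurable_corner σ _) hB, Measure.prod_apply (measurable_corner σ _ hB),
    Measure.smul_apply, smul_eq_mul]
  have hHm : ∀ τ : Fin d → Fin (d + m),
      Measurable fun u => uniformSample d {t | corner σ u τ t ∈ B} := fun τ =>
    measurable_measure_prodMk_left (hSm τ)
  change ∫⁻ u, uniformSample d {t | corner σ u (Fin.castAdd m) t ∈ B} ∂(uniformSample (d + m)) ≤ _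
  set L := ∫⁻ u, uniformSample d {t | corner σ u (Fin.castAdd m) t ∈ B}
    ∂(uniformSample (d + m)) with hL
  have hexch : ∀ τ : Fin d ↪ Fin (d + m),
      ∫⁻ u, uniformSample d {t | corner σ u τ t ∈ B} ∂(uniformSample (d + m)) = L := by
    intro τ
    obtain ⟨π, hπ⟩ := Equiv.Perm.exists_extending_pair (Fin.castAdd m : Fin d → Fin (d + m)) τ
      (Fin.castAdd_injective d m) τ.injective
    have hmp := measurePreserving_comp_injective (n := d + m) π.injective
    rw [hL, ← hmp.lintegral_comp (hHm (Fin.castAdd m))]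
    refine lintegral_congr fun u => ?_
    have : ∀ t, corner σ (fun i => u (π i)) (Fin.castAdd m) t = corner σ u τ t := fun t => by
      ext j
      simp only [corner, meanAt_comp_perm, widthAt_comp_perm, hπ]
    change _ = uniformSample d {t | corner σ (fun i => u (π i)) (Fin.castAdd m) t ∈ B}
    congr 1
    ext t
    rw [Set.mem_ofPred_eq, Set.mem_ofPred_eq, this]
  have hcard : ((d + m).descFactorial d : ℝ≥0∞) * L ≤
      ENNReal.ofReal ((2 * ((d + m : ℕ) + 1)) ^ d) * uniformSample d B := by
    calc ((d + m).descFactorial d : ℝ≥0∞) * L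
        = ∑ τ : Fin d ↪ Fin (d + m),
          ∫⁻ u, uniformSample d {t | corner σ u τ t ∈ B} ∂(uniformSample (d + m)) := by
          rw [Finset.sum_congr rfl fun τ _ => hexch τ, Finset.sum_const, Finset.card_univ,
            Fintype.card_embedding_eq, Fintype.card_fin, Fintype.card_fin, nsmul_eq_mul]
      _ = ∫⁻ u, ∑ τ : Fin d ↪ Fin (d + m), uniformSample d {t | corner σ u τ t ∈ B}
          ∂(uniformSample (d + m)) :=
          (lintegral_finsetSum (Finset.univ : Finset (Fin d ↪ Fin (d + m))) fun τ _ => hHm ⇑τ).symm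
      _ ≤ ∫⁻ _u, ENNReal.ofReal ((2 * ((d + m : ℕ) + 1)) ^ d) * uniformSample d B
          ∂(uniformSample (d + m)) := by
          refine lintegral_mono_ae ?_
          filter_upwards [ae_good (d + m)] with u hu
          exact sum_uniformSample_corner_preimage_le σ hu.2.1 hu.2.2 hB
      _ = _ := by simp
  -- There are at least `(m + 1) ^ d` choices of distinct observations, and
  -- `d + m + 1 ≤ (d + 1) * (m + 1)`; so the constant does not depend on `m`.
  have hfac : ((m + 1 : ℕ) : ℝ≥0∞) ^ d ≤ ((d + m).descFactorial d : ℝ≥0∞) := by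
    have h := Nat.pow_sub_le_descFactorial (d + m) d
    rw [show d + m + 1 - d = m + 1 by omega] at h
    exact_mod_cast h
  have hconst : ENNReal.ofReal ((2 * ((d + m : ℕ) + 1)) ^ d) ≤
      ((m + 1 : ℕ) : ℝ≥0∞) ^ d * ENNReal.ofReal ((2 * (d + 1)) ^ d) := by
    rw [← ENNReal.ofReal_natCast, ← ENNReal.ofReal_pow (by positivity),
      ← ENNReal.ofReal_mul (by positivity), ← mul_pow]
    refine ENNReal.ofReal_le_ofReal (pow_le_pow_left₀ (by positivity) ?_ d)
    push_cast
    nlinarith [mul_nonneg (Nat.cast_nonneg (α := ℝ) m) (Nat.cast_nonneg (α := ℝ) d)]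
  have h0 : ((m + 1 : ℕ) : ℝ≥0∞) ^ d ≠ 0 := pow_ne_zero _ (by simp)
  have htop : ((m + 1 : ℕ) : ℝ≥0∞) ^ d ≠ ∞ := ENNReal.pow_ne_top (ENNReal.natCast_ne_top _)
  refine (ENNReal.mul_le_mul_iff_right h0 htop).1 ?_
  calc ((m + 1 : ℕ) : ℝ≥0∞) ^ d * L ≤ ((d + m).descFactorial d : ℝ≥0∞) * L := by gcongr
    _ ≤ _ := hcard
    _ ≤ ((m + 1 : ℕ) : ℝ≥0∞) ^ d * ENNReal.ofReal ((2 * (d + 1)) ^ d) * uniformSample d B := by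
        gcongr
    _ = _ := mul_assoc _ _ _

/-! ### The corners are close to the observations -/

/-- The cells of the `n` observations are disjoint subintervals of `(0, 1)`, and the observations
are exchangeable. -/
theorem lintegral_widthAt_le {n : ℕ} (i : Fin n) :
    ∫⁻ u, ENNReal.ofReal (widthAt u i) ∂(uniformSample n) ≤ (n : ℝ≥0∞)⁻¹ := by
  have hm : ∀ l : Fin n, Measurable fun u : Fin n → ℝ => ENNReal.ofReal (widthAt u l) := fun l =>
    (measurable_widthAt l).ennreal_ofReal
  have hexch : ∀ l : Fin n, ∫⁻ u, ENNReal.ofReal (widthAt u l) ∂(uniformSample n) =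
      ∫⁻ u, ENNReal.ofReal (widthAt u i) ∂(uniformSample n) := fun l => by
    rw [← (measurePreserving_comp_injective (Equiv.swap i l).injective).lintegral_comp (hm i)]
    refine lintegral_congr fun u => ?_
    rw [widthAt_comp_perm, Equiv.swap_apply_left]
  have hsum : (n : ℝ≥0∞) * ∫⁻ u, ENNReal.ofReal (widthAt u i) ∂(uniformSample n) ≤ 1 := by
    calc _ = ∑ l, ∫⁻ u, ENNReal.ofReal (widthAt u l) ∂(uniformSample n) := by
          rw [Finset.sum_congr rfl fun l _ => hexch l]; simp
      _ = ∫⁻ u, ∑ l, ENNReal.ofReal (widthAt u l) ∂(uniformSample n) :=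
          (lintegral_finsetSum _ fun l _ => hm l).symm
      _ ≤ ∫⁻ _u, 1 ∂(uniformSample n) := by
          refine lintegral_mono_ae ?_
          filter_upwards [ae_good n] with u hu
          calc ∑ l, ENNReal.ofReal (widthAt u l) = ∑ l, uniformLaw (cell true u l) := by
                refine Finset.sum_congr rfl fun l _ => ?_
                rw [Measure.restrict_apply (measurableSet_cell _ _ _),
                  Set.inter_eq_left.2 (cell_subset_Ioo hu.2.1 _ _), volume_cell]
            _ ≤ uniformLaw Set.univ :=
                sum_measure_le_measure_univ
                  (fun l _ => (measurableSet_cell _ _ _).nullMeasurableSet)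
                  fun l _ l' _ hne => (disjoint_cell hu.2.2 true hne).aedisjoint
            _ = 1 := measure_univ
      _ = 1 := by simp
  rw [← one_div, ENNReal.le_div_iff_mul_le (Or.inr one_ne_zero) (Or.inr ENNReal.one_ne_top),
    mul_comm]
  exact hsum

/-- Almost every sample lies in a cell of positive probability, so that the conditional mean is
genuine there. -/
theorem ae_integral_cond_eq_meanAt {n : ℕ} (l : Fin n) : ∀ᵐ u ∂(uniformSample n),
    ∫ v, v l ∂(ProbabilityTheory.cond (uniformSample n)
      {v | numBelow (1 / 2) v = numBelow (1 / 2) u ∧ numAbove (1 / 2) v = numAbove (1 / 2) u ∧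
        rank v l = rank u l}) = meanAt u l := by
  filter_upwards [ae_measure_fiber_ne_zero (uniformSample n) fun u : Fin n → ℝ =>
    (numBelow (1 / 2) u, numAbove (1 / 2) u, rank u l)] with u hu
  refine integral_cond_eq_condMean l ?_
  convert hu using 2
  ext v
  simp [Prod.ext_iff]

/-- Being a conditional mean, `meanAt u l` approximates `u l` at least as well as the normalised
rank does; no computation with order statistics is needed for its consistency. -/
theorem eLpNorm_meanAt_sub_le {n : ℕ} (l : Fin n) :
    eLpNorm (fun u => meanAt u l - u l) 2 (uniformSample n) ≤
      eLpNorm (fun u => (rank u l : ℝ) / n - u l) 2 (uniformSample n) := by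
  have hX : MemLp (fun u : Fin n → ℝ => u l) 2 (uniformSample n) := by
    refine MemLp.of_bound (measurable_pi_apply l).aestronglyMeasurable 1 ?_
    filter_upwards [ae_mem_openCube n] with u hu
    rw [Real.norm_eq_abs, abs_of_pos (hu l).1]
    exact (hu l).2.le
  have hY : Measurable fun u : Fin n → ℝ => (numBelow (1 / 2) u, numAbove (1 / 2) u, rank u l) :=
    (measurable_numBelow _).prodMk ((measurable_numAbove _).prodMk (measurable_rank l))
  refine le_trans (le_of_eq ?_) (eLpNorm_cellMean_sub_le hX
    (fun y => hY (measurableSet_singleton y)) fun y => (y.2.2 : ℝ) / n)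
  refine eLpNorm_congr_ae ?_
  filter_upwards [ae_integral_cond_eq_meanAt l] with u hu
  rw [← hu]
  congr 4
  ext v
  simp [Prod.ext_iff]

theorem tendsto_measure_of_tendsto_eLpNorm {α : ℕ → Type*} [∀ m, MeasurableSpace (α m)]
    {P : ∀ m, Measure (α m)} {f : ∀ m, α m → ℝ} (hf : ∀ m, AEStronglyMeasurable (f m) (P m))
    {p : ℝ≥0∞} (hp0 : p ≠ 0) (hp : p ≠ ∞)
    (h : Tendsto (fun m => eLpNorm (f m) p (P m)) atTop (𝓝 0)) {ρ : ℝ} (hρ : 0 < ρ) :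
    Tendsto (fun m => P m {ω | ρ ≤ |f m ω|}) atTop (𝓝 0) := by
  have hρ' : ENNReal.ofReal ρ ≠ 0 := by simpa using hρ
  have h1 : Tendsto (fun m => (ENNReal.ofReal ρ)⁻¹ ^ p.toReal * eLpNorm (f m) p (P m) ^ p.toReal)
      atTop (𝓝 0) := by
    have h2 := h.ennrpow_const p.toReal
    rw [ENNReal.zero_rpow_of_pos (ENNReal.toReal_pos hp0 hp)] at h2
    have := ENNReal.Tendsto.const_mul (a := (ENNReal.ofReal ρ)⁻¹ ^ p.toReal) h2
      (Or.inr (ENNReal.rpow_ne_top_of_nonneg ENNReal.toReal_nonneg (ENNReal.inv_ne_top.2 hρ')))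
    simpa using this
  refine tendsto_of_tendsto_of_tendsto_of_le_of_le tendsto_const_nhds h1 (fun _ => zero_le)
    fun m => ?_
  refine le_trans (measure_mono fun ω hω => ?_)
    (meas_ge_le_mul_pow_eLpNorm_enorm (P m) hp0 hp (hf m) hρ' (by simp))
  have hω' : ρ ≤ |f m ω| := hω
  change ENNReal.ofReal ρ ≤ ‖f m ω‖ₑ
  rw [Real.enorm_eq_ofReal_abs]
  exact ENNReal.ofReal_le_ofReal hω'

theorem tendsto_measure_dist_of_coord {d : ℕ} {α : ℕ → Type*} [∀ m, MeasurableSpace (α m)]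
    {P : ∀ m, Measure (α m)} {X W : ∀ m, α m → Fin d → ℝ} {ρ : ℝ} (hρ : 0 < ρ)
    (h : ∀ j, Tendsto (fun m => P m {ω | ρ ≤ |X m ω j - W m ω j|}) atTop (𝓝 0)) :
    Tendsto (fun m => P m {ω | ρ ≤ dist (X m ω) (W m ω)}) atTop (𝓝 0) := by
  have h1 : Tendsto (fun m => ∑ j, P m {ω | ρ ≤ |X m ω j - W m ω j|}) atTop (𝓝 0) := by
    simpa using tendsto_finsetSum Finset.univ fun j _ => h j
  refine tendsto_of_tendsto_of_tendsto_of_le_of_le tendsto_const_nhds h1 (fun _ => zero_le)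
    fun m => ?_
  refine (measure_mono fun ω hω => ?_).trans (measure_iUnion_fintype_le (P m) _)
  by_contra hcon
  simp only [Set.mem_iUnion, Set.mem_ofPred_eq, not_exists, not_le] at hcon
  exact (not_lt.2 (show ρ ≤ dist (X m ω) (W m ω) from hω))
    ((dist_pi_lt_iff hρ).2 fun j => by rw [Real.dist_eq]; exact hcon j)

theorem tendsto_measure_corner_dist (d : ℕ) (σ : Fin d → Bool) {ρ : ℝ} (hρ : 0 < ρ) :
    Tendsto (fun m => ((uniformSample (d + m)).prod (uniformSample d))
      {p | ρ ≤ dist (corner σ p.1 (Fin.castAdd m) p.2) (fun j => p.1 (Fin.castAdd m j))})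
      atTop (𝓝 0) := by
  refine tendsto_measure_dist_of_coord hρ fun j => ?_
  have h1 : Tendsto (fun m => uniformSample (d + m)
      {u | ρ / 2 ≤ |meanAt u (Fin.castAdd m j) - u (Fin.castAdd m j)|}) atTop (𝓝 0) := by
    refine tendsto_measure_of_tendsto_eLpNorm (p := 2)
      (fun m => ((measurable_meanAt _).sub (measurable_pi_apply _)).aestronglyMeasurable)
      two_ne_zero ENNReal.ofNat_ne_top ?_ (half_pos hρ)
    exact tendsto_of_tendsto_of_tendsto_of_le_of_le tendsto_const_nhds
      (tendsto_eLpNorm_rank_div_sub j) (fun _ => zero_le) fun m => eLpNorm_meanAt_sub_le _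
  have h2 : Tendsto (fun m => uniformSample (d + m)
      {u | ρ / 2 ≤ |widthAt u (Fin.castAdd m j)|}) atTop (𝓝 0) := by
    refine tendsto_measure_of_tendsto_eLpNorm (p := 1)
      (fun m => (measurable_widthAt _).aestronglyMeasurable)
      one_ne_zero ENNReal.one_ne_top ?_ (half_pos hρ)
    refine tendsto_of_tendsto_of_tendsto_of_le_of_le tendsto_const_nhds
      (tendsto_inv_sampleSize d) (fun _ => zero_le) fun m => ?_
    rw [eLpNorm_one_eq_lintegral_enorm]
    refine le_trans (le_of_eq ?_) (lintegral_widthAt_le (Fin.castAdd m j))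
    refine lintegral_congr fun u => ?_
    rw [Real.enorm_eq_ofReal_abs, abs_of_pos (widthAt_pos _ _)]
  have h3 := h1.add h2
  rw [add_zero] at h3
  refine tendsto_of_tendsto_of_tendsto_of_le_of_le tendsto_const_nhds h3 (fun _ => zero_le)
    fun m => ?_
  have hfst : MeasurePreserving (Prod.fst : (Fin (d + m) → ℝ) × (Fin d → ℝ) → _)
    ((uniformSample (d + m)).prod (uniformSample d)) (uniformSample (d + m)) :=
    measurePreserving_fst
  have hsnd : MeasurePreserving (Prod.snd : (Fin (d + m) → ℝ) × (Fin d → ℝ) → _)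
    ((uniformSample (d + m)).prod (uniformSample d)) (uniformSample d) :=
    measurePreserving_snd
  set S1 := {u : Fin (d + m) → ℝ | ρ / 2 ≤ |meanAt u (Fin.castAdd m j) - u (Fin.castAdd m j)|}
  set S2 := {u : Fin (d + m) → ℝ | ρ / 2 ≤ |widthAt u (Fin.castAdd m j)|}
  have hS1 : MeasurableSet S1 := measurableSet_le measurable_const
    (continuous_abs.measurable.comp ((measurable_meanAt _).sub (measurable_pi_apply _)))
  have hS2 : MeasurableSet S2 := measurableSet_le measurable_const
    (continuous_abs.measurable.comp (measurable_widthAt _))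
  calc _ ≤ ((uniformSample (d + m)).prod (uniformSample d))
        (Prod.fst ⁻¹' S1 ∪ Prod.fst ⁻¹' S2) := by
        refine measure_mono_ae ?_
        filter_upwards [hsnd.quasiMeasurePreserving.ae (ae_mem_openCube d)] with p hp hpρ
        by_contra hcon
        have hn1 : |meanAt p.1 (Fin.castAdd m j) - p.1 (Fin.castAdd m j)| < ρ / 2 :=
          not_le.1 fun h => hcon (Or.inl h)
        have hn2 : |widthAt p.1 (Fin.castAdd m j)| < ρ / 2 := not_le.1 fun h => hcon (Or.inr h)
        have hpρ' : ρ ≤ |corner σ p.1 (Fin.castAdd m) p.2 j - p.1 (Fin.castAdd m j)| := hpρ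
        have h4 : |sgn (σ j) * (p.2 j * widthAt p.1 (Fin.castAdd m j))| ≤
            |widthAt p.1 (Fin.castAdd m j)| := by
          rw [abs_mul, abs_sgn, one_mul, abs_mul, abs_of_pos (hp j).1]
          exact mul_le_of_le_one_left (abs_nonneg _) (hp j).2.le
        have h5 : corner σ p.1 (Fin.castAdd m) p.2 j - p.1 (Fin.castAdd m j) =
          (meanAt p.1 (Fin.castAdd m j) - p.1 (Fin.castAdd m j)) +
            sgn (σ j) * (p.2 j * widthAt p.1 (Fin.castAdd m j)) := by
          simp only [corner]; ring
        rw [h5] at hpρ'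
        have := abs_add_le (meanAt p.1 (Fin.castAdd m j) - p.1 (Fin.castAdd m j))
          (sgn (σ j) * (p.2 j * widthAt p.1 (Fin.castAdd m j)))
        linarith
    _ ≤ _ := measure_union_le _ _
    _ = _ := by
        rw [hfst.measure_preimage hS1.nullMeasurableSet,
          hfst.measure_preimage hS2.nullMeasurableSet]

/-! ### Functions that are monotone in each argument -/

theorem MonotoneInEachArgument.neg {d : ℕ} {g : (Fin d → ℝ) → ℝ}
    (hg : MonotoneInEachArgument g) : MonotoneInEachArgument fun x => -g x := by
  intro x hx j
  rcases hg x hx j with h | h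
  · exact Or.inr h.neg
  · exact Or.inl h.neg

/-- Moving one coordinate after the other to an endpoint does not decrease `g`, if the endpoint is
chosen according to the direction of monotonicity at the current point; that direction may depend on
the other coordinates. -/
theorem MonotoneInEachArgument.exists_le {d : ℕ} {g : (Fin d → ℝ) → ℝ}
    (hg : MonotoneInEachArgument g) {x : Fin d → ℝ} (hx : x ∈ openCube d)
    {y : Bool → Fin d → ℝ} (hy : ∀ b, y b ∈ openCube d) (hyx : ∀ j, y false j ≤ x j)
    (hxy : ∀ j, x j ≤ y true j) : ∃ σ : Fin d → Bool, g x ≤ g fun j => y (σ j) j := by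
  have key : ∀ s : Finset (Fin d), ∃ σ : Fin d → Bool,
      g x ≤ g fun j => if j ∈ s then y (σ j) j else x j := by
    intro s
    induction s using Finset.induction_on with
    | empty => exact ⟨fun _ => true, by simp⟩
    | insert i s his ih =>
      obtain ⟨σ, hσ⟩ := ih
      set z : Fin d → ℝ := fun j => if j ∈ s then y (σ j) j else x j with hz
      have hzc : z ∈ openCube d := fun j => by
        by_cases hj : j ∈ s
        · simpa [hz, hj] using hy (σ j) j
        · simpa [hz, hj] using hx j
      have hzi : Function.update z i (x i) = z := by
        rw [Function.update_eq_self_iff]; simp [hz, his]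
      have hstep : ∃ b, g z ≤ g (Function.update z i (y b i)) := by
        rcases hg z hzc i with h | h
        · refine ⟨true, ?_⟩
          have := h (hx i) (hy true i) (hxy i)
          simpa only [hzi] using this
        · refine ⟨false, ?_⟩
          have := h (hy false i) (hx i) (hyx i)
          simpa only [hzi] using this
      obtain ⟨b, hb⟩ := hstep
      refine ⟨Function.update σ i b, (hσ.trans hb).trans (le_of_eq ?_)⟩
      congr 1
      ext j
      by_cases hj : j = i
      · subst hj; simp
      · simp [hj, hz]
  simpa using key Finset.univ

/-- A function that is monotone in each argument is controlled, at any point of a box, by its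
values at the vertices. -/
theorem MonotoneInEachArgument.abs_sub_le_sum {d : ℕ} {g : (Fin d → ℝ) → ℝ}
    (hg : MonotoneInEachArgument g) {x : Fin d → ℝ} (hx : x ∈ openCube d)
    {y : Bool → Fin d → ℝ} (hy : ∀ b, y b ∈ openCube d) (hyx : ∀ j, y false j ≤ x j)
    (hxy : ∀ j, x j ≤ y true j) (c : ℝ) :
    |g x - c| ≤ ∑ σ : Fin d → Bool, |g (fun j => y (σ j) j) - c| := by
  obtain ⟨σ, hσ⟩ := hg.exists_le hx hy hyx hxy
  obtain ⟨σ', hσ'⟩ := hg.neg.exists_le hx hy hyx hxy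
  have hle : ∀ σ : Fin d → Bool, |g (fun j => y (σ j) j) - c| ≤
      ∑ σ : Fin d → Bool, |g (fun j => y (σ j) j) - c| := fun σ =>
    Finset.single_le_sum (f := fun σ : Fin d → Bool => |g (fun j => y (σ j) j) - c|)
      (fun _ _ => abs_nonneg _) (Finset.mem_univ σ)
  rw [abs_le']
  constructor
  · exact le_trans (by linarith [le_abs_self (g (fun j => y (σ j) j) - c)]) (hle σ)
  · exact le_trans (by linarith [neg_abs_le (g (fun j => y (σ' j) j) - c)]) (hle σ')

/-! ### The error of the scores for uniform samples -/

/-- The difference between the score of the sign counts and ranks of a sample `u` from the uniform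
distribution over `(0, 1)`, with `1/2` in the role of the median, and the value of `φ` at the first
`k + 1` observations. -/
def scoreError (k : ℕ) (a : ScoreFunction k) (φ : (Fin (k + 1) → ℝ) → ℝ) (m : ℕ)
    (u : Fin (k + 1 + m) → ℝ) : ℝ :=
  a m (numBelow (1 / 2) u, numAbove (1 / 2) u) (fun j => rank u (Fin.castAdd m j)) -
    φ fun j => u (Fin.castAdd m j)

theorem measurable_countRankSummary (d m : ℕ) :
    Measurable fun u : Fin (d + m) → ℝ =>
      ((numBelow (1 / 2) u, numAbove (1 / 2) u), fun j : Fin d => rank u (Fin.castAdd m j)) :=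
  ((measurable_numBelow _).prodMk (measurable_numAbove _)).prodMk
    (measurable_pi_lambda _ fun _ => measurable_rank _)

theorem measurable_countRank {d m : ℕ} {β : Type*} [MeasurableSpace β]
    (F : (ℕ × ℕ) × (Fin d → ℕ) → β) :
    Measurable fun u : Fin (d + m) → ℝ =>
      F ((numBelow (1 / 2) u, numAbove (1 / 2) u), fun j : Fin d => rank u (Fin.castAdd m j)) :=
  (measurable_of_countable F).comp (measurable_countRankSummary d m)

theorem measurePreserving_initial (d m : ℕ) :
    MeasurePreserving (fun (u : Fin (d + m) → ℝ) (j : Fin d) => u (Fin.castAdd m j))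
      (uniformSample (d + m)) (uniformSample d) :=
  measurePreserving_comp_injective (Fin.castAdd_injective d m)

theorem SquareIntegrable.memLp {d : ℕ} {φ : (Fin d → ℝ) → ℝ} (hφ : SquareIntegrable φ) :
    MemLp φ 2 (uniformSample d) := by
  rw [uniformSample_eq]; exact hφ

theorem SquareIntegrable.memLp_initial {d : ℕ} {φ : (Fin d → ℝ) → ℝ} (hφ : SquareIntegrable φ)
    (m : ℕ) : MemLp (fun u : Fin (d + m) → ℝ => φ fun j => u (Fin.castAdd m j)) 2
      (uniformSample (d + m)) :=
  hφ.memLp.comp_measurePreserving (measurePreserving_initial d m)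

theorem memLp_scoreError {k : ℕ} (a : ScoreFunction k) {φ : (Fin (k + 1) → ℝ) → ℝ}
    (hφ : SquareIntegrable φ) (m : ℕ) :
    MemLp (scoreError k a φ m) 2 (uniformSample (k + 1 + m)) := by
  refine MemLp.sub ?_ (hφ.memLp_initial m)
  refine memLp_of_countable_range
    (fun y => measurable_countRankSummary (k + 1) m (measurableSet_singleton y))
    (S := (Set.Iic (k + 1 + m) ×ˢ Set.Iic (k + 1 + m)) ×ˢ
      Set.univ.pi fun _ => Set.Iic (k + 1 + m))
    (((Set.finite_Iic _).prod (Set.finite_Iic _)).prod (Set.Finite.pi fun _ => Set.finite_Iic _))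
    (fun u => ⟨⟨numBelow_le _ _, numAbove_le _ _⟩, fun j _ => rank_le _ _⟩)
    fun y => a m y.1 y.2

/-! ### Exact scores -/

theorem tendsto_measure_rankVector_dist (d : ℕ) {ρ : ℝ} (hρ : 0 < ρ) :
    Tendsto (fun m => uniformSample (d + m)
      {u | ρ ≤ dist (fun j : Fin d => (rank u (Fin.castAdd m j) : ℝ) / ((d + m : ℕ) : ℝ))
        (fun j => u (Fin.castAdd m j))}) atTop (𝓝 0) := by
  refine tendsto_measure_dist_of_coord hρ fun j => ?_
  refine tendsto_measure_of_tendsto_eLpNorm (p := 2) (fun m => ?_) two_ne_zero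
    ENNReal.ofNat_ne_top (tendsto_eLpNorm_rank_div_sub j) hρ
  exact ((measurable_countSummary (fun _ _ r => (r : ℝ) / ((d + m : ℕ) : ℝ)) _).sub
    (measurable_pi_apply _)).aestronglyMeasurable

/-- The exact scores are cell means, hence at least as good as `h` evaluated at the normalised
ranks, for a continuous approximation `h` to `φ`. -/
theorem tendsto_eLpNorm_scoreError_exact {k : ℕ} {φ : (Fin (k + 1) → ℝ) → ℝ}
    (hφ : SquareIntegrable φ) :
    Tendsto (fun m => eLpNorm (scoreError k (exactScore k φ) φ m) 2 (uniformSample (k + 1 + m)))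
      atTop (𝓝 0) := by
  rw [ENNReal.tendsto_nhds_zero]
  intro ε hε
  have hε2 : ε / 2 ≠ 0 := (ENNReal.half_pos hε.ne').ne'
  obtain ⟨h, hs, hφh, hc, hh⟩ :=
    hφ.memLp.exists_hasCompactSupport_eLpNorm_sub_le ENNReal.ofNat_ne_top hε2
  have hVm : ∀ m, Measurable fun (u : Fin (k + 1 + m) → ℝ) (j : Fin (k + 1)) =>
      (rank u (Fin.castAdd m j) : ℝ) / ((k + 1 + m : ℕ) : ℝ) := fun m =>
    measurable_pi_lambda _ fun j =>
      measurable_countSummary (fun _ _ r => (r : ℝ) / ((k + 1 + m : ℕ) : ℝ)) _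
  have hlim := tendsto_eLpNorm_comp_sub_comp_of_compactSupport hVm
    (fun m => (measurePreserving_initial (k + 1) m).measurable)
    (fun ρ hρ => tendsto_measure_rankVector_dist (k + 1) hρ) hc hs
  filter_upwards [ENNReal.tendsto_nhds_zero.1 hlim (ε / 2) (pos_iff_ne_zero.2 hε2)] with m hm
  have hbest := eLpNorm_cellMean_sub_le (hφ.memLp_initial m)
    (fun y => measurable_countRankSummary (k + 1) m (measurableSet_singleton y))
    fun y => h fun j => (y.2 j : ℝ) / ((k + 1 + m : ℕ) : ℝ)
  have heq : scoreError k (exactScore k φ) φ m = fun u =>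
      ∫ v, φ (fun j => v (Fin.castAdd m j)) ∂(ProbabilityTheory.cond (uniformSample (k + 1 + m))
        ((fun u : Fin (k + 1 + m) → ℝ => ((numBelow (1 / 2) u, numAbove (1 / 2) u),
          fun j : Fin (k + 1) => rank u (Fin.castAdd m j))) ⁻¹'
          {((numBelow (1 / 2) u, numAbove (1 / 2) u),
            fun j : Fin (k + 1) => rank u (Fin.castAdd m j))})) -
        φ fun j => u (Fin.castAdd m j) := by
    ext u
    rw [scoreError, exactScore]
    congr 4
    ext v
    simp [Prod.ext_iff, funext_iff, and_assoc]
  rw [heq]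
  refine hbest.trans ?_
  have m1 : AEStronglyMeasurable (fun u : Fin (k + 1 + m) → ℝ =>
      h (fun j => (rank u (Fin.castAdd m j) : ℝ) / ((k + 1 + m : ℕ) : ℝ)) -
        h fun j => u (Fin.castAdd m j)) (uniformSample (k + 1 + m)) :=
    ((hc.measurable.comp (hVm m)).sub
      (hc.measurable.comp (measurePreserving_initial (k + 1) m).measurable)).aestronglyMeasurable
  have m2 : MemLp (fun u : Fin (k + 1 + m) → ℝ => (φ - h) fun j => u (Fin.castAdd m j)) 2
      (uniformSample (k + 1 + m)) :=
    (hφ.memLp.sub hh).comp_measurePreserving (measurePreserving_initial (k + 1) m)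
  have e : (fun u : Fin (k + 1 + m) → ℝ =>
      h (fun j => (rank u (Fin.castAdd m j) : ℝ) / ((k + 1 + m : ℕ) : ℝ)) -
        φ fun j => u (Fin.castAdd m j)) =
      (fun u : Fin (k + 1 + m) → ℝ =>
        h (fun j => (rank u (Fin.castAdd m j) : ℝ) / ((k + 1 + m : ℕ) : ℝ)) -
        h fun j => u (Fin.castAdd m j)) - fun u => (φ - h) fun j => u (Fin.castAdd m j) := by
    ext u; simp only [Pi.sub_apply]; ring
  rw [e]
  calc _ ≤ _ := eLpNorm_sub_le m1 m2.1 (by norm_num)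
    _ ≤ ε / 2 + ε / 2 := by
        refine add_le_add hm (le_trans (le_of_eq ?_) hφh)
        exact eLpNorm_comp_measurePreserving (g := φ - h) (hφ.memLp.sub hh).1
          (measurePreserving_initial (k + 1) m)
    _ = ε := ENNReal.add_halves ε

/-! ### Approximate scores -/

/-- The conditional means take countably many values, so nothing can be said about `g` at them from
`g` being square-integrable. Monotonicity replaces them by corners, whose laws are dominated by the
uniform law. -/
theorem tendsto_eLpNorm_comp_meanAt_sub {d : ℕ} {g : (Fin d → ℝ) → ℝ}
    (hg : SquareIntegrable g) (hmono : MonotoneInEachArgument g) :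
    Tendsto (fun m => eLpNorm (fun u : Fin (d + m) → ℝ =>
      g (fun j => meanAt u (Fin.castAdd m j)) - g fun j => u (Fin.castAdd m j)) 2
        (uniformSample (d + m))) atTop (𝓝 0) := by
  let P : ∀ m, Measure ((Fin (d + m) → ℝ) × (Fin d → ℝ)) := fun m =>
    (uniformSample (d + m)).prod (uniformSample d)
  let X : (Fin d → Bool) → ∀ m, (Fin (d + m) → ℝ) × (Fin d → ℝ) → Fin d → ℝ := fun σ m p =>
    corner σ p.1 (Fin.castAdd m) p.2
  let W : ∀ m, (Fin (d + m) → ℝ) × (Fin d → ℝ) → Fin d → ℝ := fun m p j => p.1 (Fin.castAdd m j)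
  have hW : ∀ m, MeasurePreserving (W m) (P m) (uniformSample d) := fun m =>
    (measurePreserving_initial d m).comp measurePreserving_fst
  have hX : ∀ σ m, Measurable (X σ m) := fun σ m => measurable_corner σ _
  set C := ENNReal.ofReal ((2 * ((d : ℝ) + 1)) ^ d)
  have hC : C ≠ ∞ := ENNReal.ofReal_ne_top
  have hC1 : 1 ≤ C := by
    rw [← ENNReal.ofReal_one]
    refine ENNReal.ofReal_le_ofReal (one_le_pow₀ ?_)
    linarith [(Nat.cast_nonneg d : (0 : ℝ) ≤ d)]
  have hWμ : ∀ m, (P m).map (W m) ≤ C • uniformSample d := fun m => by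
    rw [(hW m).map_eq]
    refine Measure.le_iff.2 fun s _ => ?_
    rw [Measure.smul_apply, smul_eq_mul]
    exact le_mul_of_one_le_left' hC1
  have hlim : ∀ σ, Tendsto (fun m => eLpNorm (fun p => g (X σ m p) - g (W m p)) 2 (P m))
      atTop (𝓝 0) := fun σ =>
    tendsto_eLpNorm_comp_sub_comp hC (hX σ) (fun m => (hW m).measurable)
      (fun m => map_corner_le d m σ) hWμ (fun ρ hρ => tendsto_measure_corner_dist d σ hρ) hg.memLp
  have hsum : Tendsto (fun m => ∑ σ, eLpNorm (fun p => g (X σ m p) - g (W m p)) 2 (P m))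
      atTop (𝓝 0) := by
    simpa using tendsto_finsetSum Finset.univ fun σ _ => hlim σ
  refine tendsto_of_tendsto_of_tendsto_of_le_of_le tendsto_const_nhds hsum (fun _ => zero_le)
    fun m => ?_
  have hfst : MeasurePreserving (Prod.fst : (Fin (d + m) → ℝ) × (Fin d → ℝ) → _) (P m)
    (uniformSample (d + m)) := measurePreserving_fst
  have hsnd : MeasurePreserving (Prod.snd : (Fin (d + m) → ℝ) × (Fin d → ℝ) → _) (P m)
    (uniformSample d) := measurePreserving_snd
  have hmeas : AEStronglyMeasurable (fun u : Fin (d + m) → ℝ =>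
      g (fun j => meanAt u (Fin.castAdd m j)) - g fun j => u (Fin.castAdd m j))
        (uniformSample (d + m)) :=
    ((measurable_countRank fun y => g fun j =>
      condMean y.1.1 y.1.2 (y.2 j)).aestronglyMeasurable).sub (hg.memLp_initial m).1
  have hXW : ∀ σ, AEStronglyMeasurable (fun p => g (X σ m p) - g (W m p)) (P m) := fun σ =>
    (memLp_comp_of_map_le hC (hX σ m) (map_corner_le d m σ) hg.memLp).1.sub
      (memLp_comp_of_map_le hC (hW m).measurable (hWμ m) hg.memLp).1
  rw [← eLpNorm_comp_measurePreserving hmeas hfst]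
  calc _ ≤ eLpNorm (∑ σ, fun p => ‖g (X σ m p) - g (W m p)‖) 2 (P m) := by
        refine eLpNorm_mono_ae_real ?_
        filter_upwards [hfst.quasiMeasurePreserving.ae (ae_good (d + m)),
          hsnd.quasiMeasurePreserving.ae (ae_mem_openCube d)] with p hp hpt
        simp only [Function.comp_apply, Finset.sum_apply, Real.norm_eq_abs]
        have hw : ∀ j, 0 < p.2 j * widthAt p.1 (Fin.castAdd m j) := fun j =>
          mul_pos (hpt j).1 (widthAt_pos _ _)
        exact hmono.abs_sub_le_sum (fun j => meanAt_mem_Ioo hp.2.1 _)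
          (y := fun b => corner (fun _ => b) p.1 (Fin.castAdd m) p.2)
          (fun b j => cell_subset_Ioo hp.2.1 _ _ (corner_mem_cell (fun _ => b) p.1 _ hpt j))
          (fun j => by simp only [corner, sgn]; simp; exact (hw j).le)
          (fun j => by simp only [corner, sgn]; simp; exact (hw j).le)
          (g (W m p))
    _ ≤ ∑ σ, eLpNorm (fun p => ‖g (X σ m p) - g (W m p)‖) 2 (P m) :=
        eLpNorm_sum_le (fun σ _ => (hXW σ).norm) (by norm_num)
    _ = _ := Finset.sum_congr rfl fun σ _ => eLpNorm_norm _

theorem tendsto_eLpNorm_scoreError_approx {k : ℕ} {φ : (Fin (k + 1) → ℝ) → ℝ}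
    (hφ : IsCombinationOfMonotone φ) :
    Tendsto (fun m => eLpNorm (scoreError k (approxScore k φ) φ m) 2 (uniformSample (k + 1 + m)))
      atTop (𝓝 0) := by
  obtain ⟨r, c, g, hg, hφg⟩ := hφ
  have hsum : Tendsto (fun m => ∑ l, ‖c l‖ₑ * eLpNorm (fun u : Fin (k + 1 + m) → ℝ =>
      g l (fun j => meanAt u (Fin.castAdd m j)) - g l fun j => u (Fin.castAdd m j)) 2
        (uniformSample (k + 1 + m))) atTop (𝓝 0) := by
    have : ∀ l, Tendsto (fun m => ‖c l‖ₑ * eLpNorm (fun u : Fin (k + 1 + m) → ℝ =>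
      g l (fun j => meanAt u (Fin.castAdd m j)) - g l fun j => u (Fin.castAdd m j)) 2
        (uniformSample (k + 1 + m))) atTop (𝓝 0) := fun l => by
      simpa using ENNReal.Tendsto.const_mul (a := ‖c l‖ₑ)
        (tendsto_eLpNorm_comp_meanAt_sub (hg l).1 (hg l).2) (Or.inr enorm_ne_top)
    simpa using tendsto_finsetSum Finset.univ fun l _ => this l
  refine tendsto_of_tendsto_of_tendsto_of_le_of_le tendsto_const_nhds hsum (fun _ => zero_le)
    fun m => ?_
  have hmeas : ∀ l, AEStronglyMeasurable (fun u : Fin (k + 1 + m) → ℝ =>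
      g l (fun j => meanAt u (Fin.castAdd m j)) - g l fun j => u (Fin.castAdd m j))
        (uniformSample (k + 1 + m)) := fun l =>
    ((measurable_countRank fun y => g l fun j =>
      condMean y.1.1 y.1.2 (y.2 j)).aestronglyMeasurable).sub ((hg l).1.memLp_initial m).1
  have hae : scoreError k (approxScore k φ) φ m =ᵐ[uniformSample (k + 1 + m)]
      ∑ l, c l • fun u : Fin (k + 1 + m) → ℝ =>
        g l (fun j => meanAt u (Fin.castAdd m j)) - g l fun j => u (Fin.castAdd m j) := by
    filter_upwards [ae_good (k + 1 + m),
      ae_all_iff.2 fun l : Fin (k + 1 + m) => ae_integral_cond_eq_meanAt l] with u hu hcond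
    simp only [scoreError, approxScore, hcond]
    rw [hφg _ fun j => meanAt_mem_Ioo hu.2.1 _, hφg _ fun j => hu.1 _, ← Finset.sum_sub_distrib]
    simp only [Finset.sum_apply, Pi.smul_apply, smul_eq_mul, mul_sub]
  rw [eLpNorm_congr_ae hae]
  refine (eLpNorm_sum_le (fun l _ => (hmeas l).const_smul (c l)) (by norm_num)).trans ?_
  exact Finset.sum_le_sum fun l _ => (eLpNorm_const_smul _ _ _ _).le

/-! ### The probability integral transform -/

variable {f : ℝ → ℝ}

theorem IsZeroMedianDensity.law_Iic_zero (hf : IsZeroMedianDensity f) :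
    law f (Set.Iic 0) = 1 / 2 := by
  rw [law, withDensity_apply _ measurableSet_Iic, ← setLIntegral_congr Iio_ae_eq_Iic]
  exact hf.lintegral_neg

theorem IsZeroMedianDensity.isProbabilityMeasure (hf : IsZeroMedianDensity f) :
    IsProbabilityMeasure (law f) := by
  refine ⟨?_⟩
  rw [← measure_add_measure_compl (measurableSet_Iic (a := (0 : ℝ))), hf.law_Iic_zero,
    Set.compl_Iic, law, withDensity_apply _ measurableSet_Ioi, hf.lintegral_pos]
  exact ENNReal.add_halves 1

theorem IsZeroMedianDensity.cdf_zero (hf : IsZeroMedianDensity f) : cdf (law f) 0 = 1 / 2 := by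
  have := hf.isProbabilityMeasure
  rw [cdf_eq_real, measureReal_def, hf.law_Iic_zero]
  simp

theorem IsZeroMedianDensity.strictMono_cdf (hf : IsZeroMedianDensity f) :
    StrictMono (cdf (law f)) := by
  have := hf.isProbabilityMeasure
  intro x y hxy
  refine lt_of_le_of_ne (monotone_cdf _ hxy.le) fun heq => ?_
  have h0 : law f (Set.Ioc x y) = 0 := by
    rw [← measure_cdf (law f), StieltjesFunction.measure_Ioc, heq, sub_self, ENNReal.ofReal_zero]
  have hac : volume ≪ law f := withDensity_absolutelyContinuous'
    hf.measurable.ennreal_ofReal.aemeasurable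
    (ae_of_all _ fun x => (ENNReal.ofReal_pos.2 (hf.pos x)).ne')
  have := hac h0
  rw [Real.volume_Ioc, ENNReal.ofReal_eq_zero] at this
  linarith

theorem IsZeroMedianDensity.continuous_cdf (hf : IsZeroMedianDensity f) :
    Continuous (cdf (law f)) := by
  have := hf.isProbabilityMeasure
  rw [continuous_iff_continuousAt]
  intro x
  have h0 : law f {x} = 0 := withDensity_absolutelyContinuous _ _ (measure_singleton x)
  rw [← measure_cdf (law f), StieltjesFunction.measure_singleton, ENNReal.ofReal_eq_zero,
    sub_nonpos] at h0
  rw [(monotone_cdf (law f)).continuousAt_iff_leftLim_eq_rightLim,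
    (cdf (law f)).rightLim_eq]
  exact le_antisymm ((monotone_cdf (law f)).leftLim_le le_rfl) h0

theorem IsZeroMedianDensity.cdf_mem_Ioo (hf : IsZeroMedianDensity f) (x : ℝ) :
    cdf (law f) x ∈ Set.Ioo (0 : ℝ) 1 :=
  ⟨(cdf_nonneg _ (x - 1)).trans_lt (hf.strictMono_cdf (by linarith)),
    (hf.strictMono_cdf (show x < x + 1 by linarith)).trans_le (cdf_le_one _ _)⟩

theorem IsZeroMedianDensity.map_cdf (hf : IsZeroMedianDensity f) :
    (law f).map (cdf (law f)) = uniformLaw := by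
  have := hf.isProbabilityMeasure
  have hm : Measurable (cdf (law f)) := hf.continuous_cdf.measurable
  have := Measure.isProbabilityMeasure_map (μ := law f) hm.aemeasurable
  refine Measure.ext_of_Iic _ _ fun a => ?_
  rw [Measure.map_apply hm measurableSet_Iic, Measure.restrict_apply measurableSet_Iic]
  rcases le_or_gt a 0 with ha | ha
  · have h1 : cdf (law f) ⁻¹' Set.Iic a = ∅ := by
      ext x
      have := (hf.cdf_mem_Ioo x).1
      simp only [Set.mem_preimage, Set.mem_Iic, Set.mem_empty_iff_false, iff_false, not_le]
      linarith
    have h2 : Set.Iic a ∩ Set.Ioo 0 1 = ∅ := by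
      ext x
      simp only [Set.mem_inter_iff, Set.mem_Iic, Set.mem_Ioo, Set.mem_empty_iff_false, iff_false]
      rintro ⟨b1, b2, -⟩
      linarith
    rw [h1, h2, measure_empty, measure_empty]
  rcases le_or_gt 1 a with ha1 | ha1
  · have h1 : cdf (law f) ⁻¹' Set.Iic a = Set.univ :=
      Set.eq_univ_of_forall fun x => (hf.cdf_mem_Ioo x).2.le.trans ha1
    rw [h1, measure_univ, Set.inter_eq_right.2 fun x hx => hx.2.le.trans ha1]
    simp
  · obtain ⟨x, hx⟩ : ∃ x, cdf (law f) x = a :=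
      mem_range_of_exists_le_of_exists_ge hf.continuous_cdf
        ((tendsto_cdf_atBot (law f)).eventually_le_const ha).exists
        ((tendsto_cdf_atTop (law f)).eventually_const_le ha1).exists
    have h1 : cdf (law f) ⁻¹' Set.Iic a = Set.Iic x := by
      ext y
      simp only [Set.mem_preimage, Set.mem_Iic, ← hx, hf.strictMono_cdf.le_iff_le]
    have h2 : Set.Iic a ∩ Set.Ioo 0 1 = Set.Ioc 0 a := by
      ext y
      simp only [Set.mem_inter_iff, Set.mem_Iic, Set.mem_Ioo, Set.mem_Ioc]
      exact ⟨fun h => ⟨h.2.1, h.1⟩, fun h => ⟨h.2, h.1, h.2.trans_lt ha1⟩⟩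
    rw [h1, h2, ← ofReal_cdf, hx, Real.volume_Ioc, sub_zero]

/-! ### Reduction of score generation to uniform samples -/

theorem sqError_eq_scoreError_sq (hf : IsZeroMedianDensity f) (k : ℕ) (a : ScoreFunction k)
    (φ : (Fin (k + 1) → ℝ) → ℝ) (m : ℕ) {π : Equiv.Perm (Fin (k + 1 + m))}
    (hπ : ∀ j : Fin (k + 1), π (Fin.castAdd m j) = Fin.castAdd m j.rev)
    (z : Fin (k + 1 + m) → ℝ) :
    sqError k a φ f m z = scoreError k a φ m (fun i => cdf (law f) (z (π i))) ^ 2 := by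
  have hlt : ∀ x y, cdf (law f) x < cdf (law f) y ↔ x < y := fun x y =>
    hf.strictMono_cdf.lt_iff_lt
  have hle : ∀ x y, cdf (law f) x ≤ cdf (law f) y ↔ x ≤ y := fun x y =>
    hf.strictMono_cdf.le_iff_le
  have h1 : numBelow (1 / 2) (fun i => cdf (law f) (z (π i))) = numBelow 0 z := by
    rw [numBelow_comp_perm (1 / 2) (fun i => cdf (law f) (z i)) π]
    simp only [numBelow, ← hf.cdf_zero, hlt]
  have h2 : numAbove (1 / 2) (fun i => cdf (law f) (z (π i))) = numAbove 0 z := by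
    rw [numAbove_comp_perm (1 / 2) (fun i => cdf (law f) (z i)) π]
    simp only [numAbove, ← hf.cdf_zero, hlt]
  have h3 : ∀ j : Fin (k + 1), rank (fun i => cdf (law f) (z (π i))) (Fin.castAdd m j) =
      rank z (Fin.castAdd m j.rev) := fun j => by
    rw [rank_comp_perm (fun i => cdf (law f) (z i)) π, hπ]
    simp only [rank, hle]
  simp only [sqError, scoreError, h1, h2, h3, hπ]

theorem IsWhiteNoise.map_cdf_perm (hf : IsZeroMedianDensity f) {Ω : Type*} [MeasurableSpace Ω]
    {P : Measure Ω} [IsProbabilityMeasure P] {n : ℕ} {Z : Fin n → Ω → ℝ}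
    (hZ : IsWhiteNoise P f Z) (π : Equiv.Perm (Fin n)) :
    MeasurePreserving (fun ω i => cdf (law f) (Z (π i) ω)) P (uniformSample n) := by
  have hm : Measurable (cdf (law f)) := hf.continuous_cdf.measurable
  have hmi : ∀ i, Measurable fun ω => cdf (law f) (Z (π i) ω) := fun i =>
    hm.comp (hZ.measurable _)
  have hind : iIndepFun (fun i ω => cdf (law f) (Z (π i) ω)) P :=
    (hZ.indep.precomp π.injective).comp (fun _ => cdf (law f)) fun _ => hm
  refine ⟨measurable_pi_lambda _ hmi, ?_⟩
  rw [(iIndepFun_iff_map_fun_eq_pi_map fun i => (hmi i).aemeasurable).1 hind]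
  unfold uniformSample
  congr 1
  ext1 i
  change P.map (cdf (law f) ∘ Z (π i)) = uniformLaw
  rw [← Measure.map_map hm (hZ.measurable _), hZ.map_eq, hf.map_cdf]

theorem eLpNorm_sq_one {α : Type*} [MeasurableSpace α] {μ : Measure α} (g : α → ℝ) :
    eLpNorm (fun ω => g ω ^ 2) 1 μ = eLpNorm g 2 μ ^ 2 := by
  rw [eLpNorm_one_eq_lintegral_enorm,
    eLpNorm_eq_lintegral_rpow_enorm_toReal two_ne_zero ENNReal.ofNat_ne_top,
    ← ENNReal.rpow_natCast, ← ENNReal.rpow_mul]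
  simp [enorm_pow]

/-- Ranks and sign counts are invariant under the distribution function, which turns the sample
into a uniform one, and conditional expectations are contractions of the mean; so mean square
convergence for uniform samples suffices. -/
theorem isScoreGenerating_of_tendsto_eLpNorm {k : ℕ} {a : ScoreFunction k}
    {φ : (Fin (k + 1) → ℝ) → ℝ} (hφ : SquareIntegrable φ)
    (h : Tendsto (fun m => eLpNorm (scoreError k a φ m) 2 (uniformSample (k + 1 + m)))
      atTop (𝓝 0)) : IsScoreGenerating.{u} k a φ := by
  intro f hf Ω _ P _ Z hZ
  have hperm : ∀ m, ∃ π : Equiv.Perm (Fin (k + 1 + m)),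
      ∀ j : Fin (k + 1), π (Fin.castAdd m j) = Fin.castAdd m j.rev := fun m =>
    Equiv.Perm.exists_extending_pair _ _ (Fin.castAdd_injective _ m)
      ((Fin.castAdd_injective _ m).comp Fin.rev_injective)
  choose π hπ using hperm
  have hU := fun m => (hZ m).map_cdf_perm hf (π m)
  have hsq : ∀ m, (fun ω => sqError k a φ f m fun i => Z m i ω) = fun ω =>
      scoreError k a φ m (fun i => cdf (law f) (Z m (π m i) ω)) ^ 2 := fun m => by
    ext ω
    exact sqError_eq_scoreError_sq hf k a φ m (hπ m) _
  refine ⟨fun m => ?_, fun ε hε => ?_⟩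
  · rw [hsq]
    exact ((memLp_scoreError a hφ m).comp_measurePreserving (hU m)).integrable_sq
  · refine tendsto_measure_of_tendsto_eLpNorm (p := 1)
      (fun m => integrable_condExp.aestronglyMeasurable) one_ne_zero ENNReal.one_ne_top ?_ hε
    have h2 : Tendsto (fun m => eLpNorm (scoreError k a φ m) 2 (uniformSample (k + 1 + m)) ^ 2)
        atTop (𝓝 0) := by
      simpa using ENNReal.Tendsto.pow (n := 2) h
    refine tendsto_of_tendsto_of_tendsto_of_le_of_le tendsto_const_nhds h2 (fun _ => zero_le)
      fun m => (eLpNorm_condExp_le_eLpNorm _ le_rfl).trans (le_of_eq ?_)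
    rw [hsq, eLpNorm_sq_one]
    rw [← eLpNorm_comp_measurePreserving (memLp_scoreError a hφ m).1 (hU m)]
    rfl

end SignRank

end

theorem lemma4p2 (k : ℕ) (hk : 1 ≤ k) (φ : (Fin (k + 1) → ℝ) → ℝ)
    (hφ : ∃ x ∈ SignRank.openCube (k + 1), ∃ y ∈ SignRank.openCube (k + 1), φ x ≠ φ y)
    (hφ2 : SignRank.SquareIntegrable φ) :
    SignRank.IsScoreGenerating.{u} k (SignRank.exactScore k φ) φ ∧
    (SignRank.IsCombinationOfMonotone φ →
      SignRank.IsScoreGenerating.{u} k (SignRank.approxScore k φ) φ) :=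
  ⟨SignRank.isScoreGenerating_of_tendsto_eLpNorm hφ2
      (SignRank.tendsto_eLpNorm_scoreError_exact hφ2),
    fun h => SignRank.isScoreGenerating_of_tendsto_eLpNorm hφ2
      (SignRank.tendsto_eLpNorm_scoreError_approx h)⟩
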